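/- **Setting.** Let $\Omega\subset\mathbb R^d$ be a bounded open set (e.g. a bounded Lipschitz domain), $T>0$, $\kappa\in\mathbb N_0$, and let $1\le\hat q\le\hat p<\infty$, $1\le q\le p<\infty$, $p>1$, $1\le r<\infty$. Let $V,\tilde V,W$ be reflexive, separable real Banach spaces, with $V$ a space of functions on $\Omega$, and let $Y$ be a real Banach space. Assume embeddings (continuous, injective) $V\hookrightarrow\tilde V\hookrightarrow W$ and $L^{\hat q}(\Omega)\hookrightarrow W$ and a compact embedding of $V$ into the Sobolev space $W^{\kappa,\hat p}(\Omega)$, compatible in the sense that $V\hookrightarrow\tilde V\hookrightarrow W$ and $V\hookrightarrow W^{\kappa,\hat p}(\Omega)\subset L^{\hat q}(\Omega)\hookrightarrow W$ coincide. Put $$\mathcal V=\{u\in L^p(0,T;V):\ \partial_tu\in L^p(0,T;\tilde V)\},\qquad \mathcal W=L^q(0,T;W),\qquad \mathcal Y=L^r(0,T;Y),$$ where $\partial_t u$ is the weak derivative, and let $\|\cdot\|_{\mathcal V}$ be any norm equivalent to $\|u\|_{L^p(0,T;V)}+\|\partial_tu\|_{L^p(0,T;\tilde V)}$. For $u\in\mathcal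 V$ let $\mathcal J_\kappa u=(D^\beta u)_{|\beta|\le\kappa}$ (spatial derivatives), let $N=\#\{\beta\in\mathbb N_0^d:|\beta|\le\kappa\}$ and $n_0=1+N$. Assume that for some $c>0$, $\|\mathcal J_\kappa u\|_{L^\infty((0,T)\times\Omega)}\le c\|u\|_{\mathcal V}$ for all $u\in\mathcal V$. For a continuous scalar law $f:\mathbb R^{n_0}\to\mathbb R$ write $f(\mathcal J_\kappa u)\in\mathcal W$ for the function $(t,x)\mapsto f(t,\mathcal J_\kappa u(t,x))$. **Networks.** Fix a depth $L\in\mathbb N_0$, widths $(n_i^\sigma)_{i=1}^L$, $(n_i^r)_{i=1}^L$, with $n_0^\sigma=n_0$, degrees $(d_i)_{i=1}^{L+1}$, continuous activations $\sigma_i:\mathbb R^{n_i^r}\to\mathbb R^{n_i^\sigma}$ and $\epsilon>0$. The network is $$\mathfrak S^\theta(z)=r_{L+1}\big((\sigma_L\circ r_L\circ\dots\circ\sigma_1\circ r_1)(z),z\big),\qquad z\in\mathbb R^{n_0},$$ where $r_i:\mathbb R^{n_{i-1}^\sigma}\to\mathbb R^{n_i^r}$ ($1\le i\le L$) and $r_{L+1}:\mathbb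 R^{n_L^\sigma+n_0}\to\mathbb R$ have as components quotients of polynomials of degree at most $d_i$. The vector $\theta$ collects all coefficients of numerators and denominators, and $\Theta$ is the set of those $\theta$ for which every denominator polynomial is $\ge\epsilon$ everywhere and has a coefficient vector of Euclidean norm $1$. Let $\mathcal R_0:\Theta\to[0,\infty]$ be proper, lower semicontinuous and coercive ($\mathcal R_0(\theta)\to\infty$ as $\|\theta\|\to\infty$). **Measurements.** All continuity notions are sequential. Let $K^\dagger:\mathcal V\to\mathcal Y$ be injective and weak-strong continuous, let $K^m:\mathcal V\to\mathcal Y$ ($m\in\mathbb N$) be weak-weak continuous, and assume $K^mv^m-K^\dagger v^m\to0$ in $\mathcal Y$ for every weakly convergent sequence $(v^m)_m$ in $\mathcal V$. Let $u^\dagger\in\mathcal V$, $y^\dagger\in\mathcal Y$ and $f^\dagger:\mathbb R^{n_0}\to\mathbb R$ satisfy $\partial_tu^\dagger=f^\dagger(\mathcal J_\kappa u^\dagger)$ in $\mathcal W$ and $K^\dagger u^\dagger=y^\dagger$, and let $f^\dagger=\mathfrak S^{\theta^\dagger}$ for some $\theta^\dagger\in\Theta$ with $\mathcal R_0(\theta^\dagger)<\infty$.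 Let $y^m\in\mathcal Y$ and $\delta(m)\ge0$ satisfy $\|y^m-K^mu^\dagger\|_{\mathcal Y}^r\le\delta(m)\to0$, and let $\lambda^m,\mu^m>0$ satisfy $\lambda^m\to\infty$, $\mu^m\to\infty$ and $\mu^m\delta(m)\to0$. For each $m$ let $(u^m,\theta^m)$ be a minimizer over $\mathcal V\times\Theta$ of $$(u,\theta)\mapsto\lambda^m\|\partial_tu-\mathfrak S^\theta(\mathcal J_\kappa u)\|_{\mathcal W}^q+\mu^m\|K^mu-y^m\|_{\mathcal Y}^r+\|u\|_{\mathcal V}^p+\mathcal R_0(\theta).$$ **Identifiability.** Assume that network laws which agree along $\mathcal J_\kappa u^\dagger$ are equal: for all $\theta_1,\theta_2\in\Theta$, $$\mathfrak S^{\theta_1}(\mathcal J_\kappa u^\dagger)=\mathfrak S^{\theta_2}(\mathcal J_\kappa u^\dagger)\ \text{in }\mathcal W\quad\Longrightarrow\quad\mathfrak S^{\theta_1}=\mathfrak S^{\theta_2}\ \text{on }\mathbb R^{n_0}.\tag{$\mathcal I$}$$ **Claim.** The whole sequence satisfies $\mathfrak S^{\theta^m}\to\mathfrak S^{\theta^\dagger}=f^\dagger$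 in $L^\infty_{\mathrm{loc}}(\mathbb R^{n_0})$ as $m\to\infty$, that is, $\|\mathfrak S^{\theta^m}-f^\dagger\|_{L^\infty(U)}\to0$ for every bounded $U\subset\mathbb R^{n_0}$. -/

import Mathlib

open MeasureTheory Filter Topology Set
open scoped ENNReal

namespace SymbolicLearning

noncomputable section

/-! ### Multi-indices, polynomials and rational functions -/

/-- Multi-indices over `ι` of order at most `d`. -/
abbrev MultiIdx (ι : Type) [Fintype ι] (d : ℕ) : Type :=
  {k : ι → Fin (d + 1) // ∑ i, (k i : ℕ) ≤ d}

/-- The multi-index of order zero. -/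
def MultiIdx.zero (ι : Type) [Fintype ι] (d : ℕ) : MultiIdx ι d :=
  ⟨fun _ => 0, by simp⟩

/-- The polynomial function of degree at most `d` with the coefficients `a`. -/
def polyEval {ι : Type} [Fintype ι] [DecidableEq ι] {d : ℕ}
    (a : MultiIdx ι d → ℝ) (x : ι → ℝ) : ℝ :=
  ∑ k : MultiIdx ι d, a k * ∏ i, x i ^ (k.1 i : ℕ)

/-- Coefficients of polynomials that are bounded below by `ε` on the whole space, normalized in
the Euclidean norm: the admissible denominators. -/
def denominators (ι : Type) [Fintype ι] [DecidableEq ι] (d : ℕ) (ε : ℝ) :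
    Set (MultiIdx ι d → ℝ) :=
  {b | (∀ x : ι → ℝ, ε ≤ polyEval b x) ∧ ∑ k, b k ^ 2 = 1}

/-- Coefficients of a numerator and of a denominator polynomial. -/
abbrev RatParam (ι : Type) [Fintype ι] [DecidableEq ι] (d : ℕ) : Type :=
  (MultiIdx ι d → ℝ) × (MultiIdx ι d → ℝ)

/-- The quotient of the numerator and the denominator polynomial. -/
def ratEval {ι : Type} [Fintype ι] [DecidableEq ι] {d : ℕ} (c : RatParam ι d) (x : ι → ℝ) : ℝ :=
  polyEval c.1 x / polyEval c.2 x

/-! ### Symbolic networks -/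

/-- Index set of the input of the `i`-th rational layer (counted from `0`): the network input,
or the output of the previous activation. -/
def LayerIn (ι : Type) (ns : ℕ → ℕ) : ℕ → Type
  | 0 => ι
  | i + 1 => Fin (ns i)

instance {ι : Type} [Fintype ι] (ns : ℕ → ℕ) : ∀ i, Fintype (LayerIn ι ns i)
  | 0 => inferInstanceAs (Fintype ι)
  | i + 1 => inferInstanceAs (Fintype (Fin (ns i)))

instance {ι : Type} [DecidableEq ι] (ns : ℕ → ℕ) : ∀ i, DecidableEq (LayerIn ι ns i)
  | 0 => inferInstanceAs (DecidableEq ι)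
  | i + 1 => inferInstanceAs (DecidableEq (Fin (ns i)))

/-- A network architecture with input space `ι → ℝ`. With layers counted from `0`, the `i`-th
hidden layer is a rational map of degree at most `deg i` with values in `ℝ^(nr i)`, followed by
the continuous activation `act i` with values in `ℝ^(ns i)`; the rational output layer has degree
at most `deg depth`. Only the widths with index below `depth` are used. -/
structure Architecture (ι : Type) where
  /-- the number of hidden layers -/
  depth : ℕ
  /-- the widths after the rational maps -/
  nr : ℕ → ℕ
  /-- the widths after the activations -/
  ns : ℕ → ℕ
  /-- the degrees of the rational maps -/
  deg : ℕ → ℕ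
  /-- the activations -/
  act : ∀ i : Fin depth, (Fin (nr i) → ℝ) → (Fin (ns i) → ℝ)
  continuous_act : ∀ i, Continuous (act i)

section Network

variable {ι : Type} [Fintype ι] [DecidableEq ι]

/-- The finite-dimensional space of all coefficient vectors: one rational function for every
component of every hidden layer, and one for the output layer, which reads the last hidden state
together with the network input. -/
abbrev Architecture.Params (A : Architecture ι) : Type :=
  (∀ i : Fin A.depth, Fin (A.nr i) → RatParam (LayerIn ι A.ns i) (A.deg i)) ×
    RatParam (LayerIn ι A.ns A.depth ⊕ ι) (A.deg A.depth)

/-- The parameter set `Θ`: all denominators are admissible. -/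
def Architecture.paramSet (A : Architecture ι) (ε : ℝ) : Set A.Params :=
  {θ | (∀ (i : Fin A.depth) (j : Fin (A.nr i)), (θ.1 i j).2 ∈
      denominators (LayerIn ι A.ns i) (A.deg i) ε) ∧
    θ.2.2 ∈ denominators (LayerIn ι A.ns A.depth ⊕ ι) (A.deg A.depth) ε}

/-- The state after the first `i` hidden layers. -/
def Architecture.hidden (A : Architecture ι) (θ : A.Params) (x : ι → ℝ) :
    ∀ i : ℕ, i ≤ A.depth → LayerIn ι A.ns i → ℝ
  | 0, _ => x
  | i + 1, h => A.act ⟨i, h⟩ fun j => ratEval (θ.1 ⟨i, h⟩ j) (A.hidden θ x i (Nat.le_of_succ_le h))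

/-- The scalar function realized by the network with the parameters `θ`. -/
def Architecture.eval (A : Architecture ι) (θ : A.Params) (x : ι → ℝ) : ℝ :=
  ratEval θ.2 (Sum.elim (A.hidden θ x A.depth le_rfl) x)

end Network

/-! ### Weak derivatives and Sobolev spaces -/

/-- Smooth functions with compact support in `U`. -/
def IsTest {E : Type*} [NormedAddCommGroup E] [NormedSpace ℝ E] (U : Set E) (φ : E → ℝ) : Prop :=
  ContDiff ℝ (⊤ : ℕ∞) φ ∧ HasCompactSupport φ ∧ tsupport φ ⊆ U

/-- The `i`-th partial derivative. -/
def partialDeriv {d : ℕ} (i : Fin d) (φ : EuclideanSpace ℝ (Fin d) → ℝ) :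
    EuclideanSpace ℝ (Fin d) → ℝ :=
  fun x => fderiv ℝ φ x (EuclideanSpace.single i 1)

/-- The iterated partial derivative of multi-index `β`. -/
def multiDeriv {d : ℕ} (β : Fin d → ℕ) (φ : EuclideanSpace ℝ (Fin d) → ℝ) :
    EuclideanSpace ℝ (Fin d) → ℝ :=
  (List.finRange d).foldr (fun i g => (partialDeriv i)^[β i] g) φ

lemma partialDeriv_regular {d : ℕ} (i : Fin d) {φ : EuclideanSpace ℝ (Fin d) → ℝ}
    (h : ContDiff ℝ (⊤ : ℕ∞) φ ∧ HasCompactSupport φ) :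
    ContDiff ℝ (⊤ : ℕ∞) (partialDeriv i φ) ∧ HasCompactSupport (partialDeriv i φ) := by
  refine ⟨?_, ?_⟩
  · exact (h.1.fderiv_right (m := (⊤ : ℕ∞)) (by simp)).clm_apply contDiff_const
  · exact h.2.fderiv_apply ℝ _

lemma multiDeriv_regular {d : ℕ} (β : Fin d → ℕ) {φ : EuclideanSpace ℝ (Fin d) → ℝ}
    (h : ContDiff ℝ (⊤ : ℕ∞) φ ∧ HasCompactSupport φ) :
    ContDiff ℝ (⊤ : ℕ∞) (multiDeriv β φ) ∧ HasCompactSupport (multiDeriv β φ) := by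
  unfold multiDeriv
  induction List.finRange d with
  | nil => exact h
  | cons i l ih =>
    simp only [List.foldr_cons]
    induction β i with
    | zero => exact ih
    | succ n ihn =>
      rw [Function.iterate_succ_apply']
      exact partialDeriv_regular i ihn

/-- Lebesgue measure on `Ω`. -/
abbrev domMeasure {d : ℕ} (Ω : Set (EuclideanSpace ℝ (Fin d))) :
    Measure (EuclideanSpace ℝ (Fin d)) := volume.restrict Ω

/-- Lebesgue measure on the time interval `(0,T)`. -/
abbrev timeMeasure (T : ℝ) : Measure ℝ := volume.restrict (Ioo 0 T)

/-- A continuous function with compact support times an `L^p` function is integrable. -/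
lemma integrable_test_smul {X F : Type*} [TopologicalSpace X] [MeasurableSpace X]
    [OpensMeasurableSpace X] [T2Space X] [NormedAddCommGroup F] [NormedSpace ℝ F]
    {μ : Measure X} [IsLocallyFiniteMeasure μ] {p : ℝ≥0∞} [hp : Fact (1 ≤ p)] {φ : X → ℝ}
    (hφ : Continuous φ) (hs : HasCompactSupport φ) (f : Lp F p μ) :
    Integrable (fun x => φ x • f x) μ :=
  ((Lp.memLp f).locallyIntegrable hp.out).integrable_smul_left_of_hasCompactSupport hφ hs

/-- The Sobolev space `W^{κ,p}(Ω)`: families `(w_β)`, `|β| ≤ κ`, in `L^p(Ω)` such that `w_β` is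
the weak derivative of order `β` of the function `w_0`, with the norm `max_β ‖w_β‖_{L^p(Ω)}`. -/
def Sobolev {d : ℕ} (Ω : Set (EuclideanSpace ℝ (Fin d))) (κ : ℕ) (p : ℝ≥0∞) [Fact (1 ≤ p)] :
    Submodule ℝ (MultiIdx (Fin d) κ → Lp ℝ p (domMeasure Ω)) where
  carrier := {w | ∀ (β : MultiIdx (Fin d) κ) (φ : EuclideanSpace ℝ (Fin d) → ℝ), IsTest Ω φ →
    ∫ x, multiDeriv (fun i => (β.1 i : ℕ)) φ x • w (MultiIdx.zero (Fin d) κ) x ∂(domMeasure Ω) =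
      (-1) ^ (∑ i, (β.1 i : ℕ)) * ∫ x, φ x • w β x ∂(domMeasure Ω)}
  zero_mem' := by
    intro β φ _
    have h0 : ∀ g : EuclideanSpace ℝ (Fin d) → ℝ,
        ∫ x, g x • (0 : Lp ℝ p (domMeasure Ω)) x ∂(domMeasure Ω) = 0 := by
      intro g
      rw [integral_congr_ae (g := fun _ => (0 : ℝ)), integral_zero]
      filter_upwards [Lp.coeFn_zero ℝ p (domMeasure Ω)] with x hx
      rw [hx, Pi.zero_apply, smul_zero]
    simp only [Pi.zero_apply, h0, mul_zero]
  add_mem' := by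
    intro v w hv hw β φ hφ
    have hadd : ∀ (g : EuclideanSpace ℝ (Fin d) → ℝ) (_ : Continuous g) (_ : HasCompactSupport g)
        (a b : Lp ℝ p (domMeasure Ω)),
        ∫ x, g x • (a + b) x ∂(domMeasure Ω) =
          ∫ x, g x • a x ∂(domMeasure Ω) + ∫ x, g x • b x ∂(domMeasure Ω) := by
      intro g hg hs a b
      rw [← integral_add (integrable_test_smul hg hs a) (integrable_test_smul hg hs b)]
      refine integral_congr_ae ?_
      filter_upwards [Lp.coeFn_add a b] with x hx
      simp only [hx, Pi.add_apply, smul_add]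
    have hr := multiDeriv_regular (fun i => (β.1 i : ℕ)) ⟨hφ.1, hφ.2.1⟩
    simp only [Pi.add_apply]
    rw [hadd _ hr.1.continuous hr.2, hadd _ hφ.1.continuous hφ.2.1, hv β φ hφ, hw β φ hφ, mul_add]
  smul_mem' := by
    intro c w hw β φ hφ
    have hsmul : ∀ (g : EuclideanSpace ℝ (Fin d) → ℝ) (a : Lp ℝ p (domMeasure Ω)),
        ∫ x, g x • (c • a) x ∂(domMeasure Ω) = c * ∫ x, g x • a x ∂(domMeasure Ω) := by
      intro g a
      rw [← integral_const_mul]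
      refine integral_congr_ae ?_
      filter_upwards [Lp.coeFn_smul c a] with x hx
      simp only [hx, Pi.smul_apply, smul_eq_mul]
      ring
    simp only [Pi.smul_apply]
    rw [hsmul, hsmul, hw β φ hφ]
    ring

/-! ### The dynamic state space -/

/-- `u'` is the weak time derivative of `ι ∘ u` on `(0,T)`, in the sense of vector-valued
distributions. -/
def HasWeakTimeDeriv {V Z : Type*} [NormedAddCommGroup V] [NormedSpace ℝ V]
    [NormedAddCommGroup Z] [NormedSpace ℝ Z] (T : ℝ) (i : V →L[ℝ] Z) (u : ℝ → V) (u' : ℝ → Z) :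
    Prop :=
  ∀ φ : ℝ → ℝ, IsTest (Ioo 0 T) φ →
    ∫ t, deriv φ t • i (u t) ∂(timeMeasure T) = - ∫ t, φ t • u' t ∂(timeMeasure T)

/-- `𝒱 = L^p(0,T;V) ∩ W^{1,p,p}(0,T;Z)` for an embedding `i : V → Z`: pairs of a function
`u ∈ L^p(0,T;V)` and its weak time derivative `u' ∈ L^p(0,T;Z)`, with the norm
`max (‖u‖_{L^p(0,T;V)}) (‖u'‖_{L^p(0,T;Z)})`. -/
def StateSpace {V Z : Type*} [NormedAddCommGroup V] [NormedSpace ℝ V]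
    [NormedAddCommGroup Z] [NormedSpace ℝ Z] (T : ℝ) (p : ℝ≥0∞) [Fact (1 ≤ p)] (i : V →L[ℝ] Z) :
    Submodule ℝ (Lp V p (timeMeasure T) × Lp Z p (timeMeasure T)) where
  carrier := {w | HasWeakTimeDeriv T i w.1 w.2}
  zero_mem' := by
    intro φ _
    have e1 : ∫ t, deriv φ t • i ((0 : Lp V p (timeMeasure T)) t) ∂(timeMeasure T) = 0 := by
      rw [integral_congr_ae (g := fun _ => (0 : Z)), integral_zero]
      filter_upwards [Lp.coeFn_zero V p (timeMeasure T)] with t ht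
      rw [ht, Pi.zero_apply, map_zero, smul_zero]
    have e2 : ∫ t, φ t • (0 : Lp Z p (timeMeasure T)) t ∂(timeMeasure T) = 0 := by
      rw [integral_congr_ae (g := fun _ => (0 : Z)), integral_zero]
      filter_upwards [Lp.coeFn_zero Z p (timeMeasure T)] with t ht
      rw [ht, Pi.zero_apply, smul_zero]
    simp only [Prod.fst_zero, Prod.snd_zero, e1, e2, neg_zero]
  add_mem' := by
    intro v w hv hw φ hφ
    have hd : Continuous (deriv φ) := hφ.1.continuous_deriv (by simp)
    have hs : HasCompactSupport (deriv φ) := hφ.2.1.deriv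
    have hint : ∀ a : Lp V p (timeMeasure T),
        Integrable (fun t => deriv φ t • i (a t)) (timeMeasure T) := by
      intro a
      refine (i.integrable_comp (integrable_test_smul hd hs a)).congr ?_
      exact Eventually.of_forall fun t => by simp
    have e1 : ∫ t, deriv φ t • i ((v + w).1 t) ∂(timeMeasure T) =
        ∫ t, deriv φ t • i (v.1 t) ∂(timeMeasure T) +
          ∫ t, deriv φ t • i (w.1 t) ∂(timeMeasure T) := by
      rw [← integral_add (hint v.1) (hint w.1)]
      refine integral_congr_ae ?_
      filter_upwards [Lp.coeFn_add v.1 w.1] with t ht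
      simp only [Prod.fst_add, ht, Pi.add_apply, map_add, smul_add]
    have e2 : ∫ t, φ t • (v + w).2 t ∂(timeMeasure T) =
        ∫ t, φ t • v.2 t ∂(timeMeasure T) + ∫ t, φ t • w.2 t ∂(timeMeasure T) := by
      rw [← integral_add (integrable_test_smul hφ.1.continuous hφ.2.1 v.2)
        (integrable_test_smul hφ.1.continuous hφ.2.1 w.2)]
      refine integral_congr_ae ?_
      filter_upwards [Lp.coeFn_add v.2 w.2] with t ht
      simp only [Prod.snd_add, ht, Pi.add_apply, smul_add]
    rw [e1, e2, hv φ hφ, hw φ hφ, neg_add]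
  smul_mem' := by
    intro c w hw φ hφ
    have e1 : ∫ t, deriv φ t • i ((c • w).1 t) ∂(timeMeasure T) =
        c • ∫ t, deriv φ t • i (w.1 t) ∂(timeMeasure T) := by
      rw [← integral_smul]
      refine integral_congr_ae ?_
      filter_upwards [Lp.coeFn_smul c w.1] with t ht
      simp only [Prod.smul_fst, ht, Pi.smul_apply, map_smul]
      rw [smul_comm]
    have e2 : ∫ t, φ t • (c • w).2 t ∂(timeMeasure T) =
        c • ∫ t, φ t • w.2 t ∂(timeMeasure T) := by
      rw [← integral_smul]
      refine integral_congr_ae ?_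
      filter_upwards [Lp.coeFn_smul c w.2] with t ht
      simp only [Prod.smul_snd, ht, Pi.smul_apply]
      rw [smul_comm]
    rw [e1, e2, hw φ hφ, smul_neg]

/-! ### Functional-analytic notions -/

/-- The canonical embedding into the bidual is onto. -/
def IsReflexive (E : Type*) [NormedAddCommGroup E] [NormedSpace ℝ E] : Prop :=
  Function.Surjective (NormedSpace.inclusionInDoubleDual ℝ E)

/-- Weak convergence of sequences. -/
def WeakTendsto {E : Type*} [NormedAddCommGroup E] [NormedSpace ℝ E] (u : ℕ → E) (v : E) : Prop :=
  ∀ l : E →L[ℝ] ℝ, Tendsto (fun n => l (u n)) atTop (𝓝 (l v))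

/-- Weakly convergent sequences are mapped to norm convergent ones. -/
def WeakStrongContinuous {E F : Type*} [NormedAddCommGroup E] [NormedSpace ℝ E]
    [NormedAddCommGroup F] (K : E → F) : Prop :=
  ∀ (u : ℕ → E) (v : E), WeakTendsto u v → Tendsto (fun n => K (u n)) atTop (𝓝 (K v))

/-- Weakly convergent sequences are mapped to weakly convergent ones. -/
def WeakWeakContinuous {E F : Type*} [NormedAddCommGroup E] [NormedSpace ℝ E]
    [NormedAddCommGroup F] [NormedSpace ℝ F] (K : E → F) : Prop :=
  ∀ (u : ℕ → E) (v : E), WeakTendsto u v → WeakTendsto (fun n => K (u n)) (K v)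

/-! ### The static spaces -/

/-- The embeddings between the static spaces `V ↪ Z ↪ W`, `V ↪↪ W^{κ,p'}(Ω)`, `L^{q'}(Ω) ↪ W`.
Since all spaces consist of functions on `Ω` and all embeddings are inclusions, the two ways
from `V` to `W` coincide. -/
structure StaticEmbeddings {d : ℕ} (Ω : Set (EuclideanSpace ℝ (Fin d))) (κ : ℕ)
    (p' q' : ℝ≥0∞) [Fact (1 ≤ p')] [Fact (1 ≤ q')] (V Z W : Type*)
    [NormedAddCommGroup V] [NormedSpace ℝ V] [NormedAddCommGroup Z] [NormedSpace ℝ Z]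
    [NormedAddCommGroup W] [NormedSpace ℝ W] where
  /-- the embedding `V ↪ Z` -/
  VZ : V →L[ℝ] Z
  /-- the embedding `Z ↪ W` -/
  ZW : Z →L[ℝ] W
  /-- the embedding of `V` into the Sobolev space -/
  VS : V →L[ℝ] Sobolev Ω κ p'
  /-- the embedding `L^{q'}(Ω) ↪ W` -/
  LW : Lp ℝ q' (domMeasure Ω) →L[ℝ] W
  VZ_injective : Function.Injective VZ
  ZW_injective : Function.Injective ZW
  VS_injective : Function.Injective VS
  VS_compact : IsCompactOperator VS
  LW_injective : Function.Injective LW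
  compatible : ∀ (v : V) (g : Lp ℝ q' (domMeasure Ω)),
    g =ᵐ[domMeasure Ω] (VS v).1 (MultiIdx.zero (Fin d) κ) → ZW (VZ v) = LW g

/-- Index set of the arguments of a physical law: time (`none`), and the spatial derivatives of
order at most `κ` of the state. -/
abbrev LawIdx (d κ : ℕ) : Type := Option (MultiIdx (Fin d) κ)

section Problem

variable {d : ℕ} {Ω : Set (EuclideanSpace ℝ (Fin d))} {κ : ℕ} {p' q' : ℝ≥0∞}
  [Fact (1 ≤ p')] [Fact (1 ≤ q')] {V Z W : Type*}
  [NormedAddCommGroup V] [NormedSpace ℝ V] [NormedAddCommGroup Z] [NormedSpace ℝ Z]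
  [NormedAddCommGroup W] [NormedSpace ℝ W]
  {T : ℝ} {p : ℝ≥0∞} [Fact (1 ≤ p)]

/-- The vector `(t, 𝒥_κ u(t,x))`. -/
def jet (E : StaticEmbeddings Ω κ p' q' V Z W) (u : StateSpace T p E.VZ) (t : ℝ)
    (x : EuclideanSpace ℝ (Fin d)) : LawIdx d κ → ℝ
  | none => t
  | some β => (E.VS (u.1.1 t)).1 β x

/-- Uniform state space regularity: `‖𝒥_κ u‖_{L^∞((0,T)×Ω)} ≤ c ‖u‖` for all `u` in the state
space. -/
def UniformRegularity (E : StaticEmbeddings Ω κ p' q' V Z W) (T : ℝ) (p : ℝ≥0∞) [Fact (1 ≤ p)] :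
    Prop :=
  ∃ c : ℝ, 0 < c ∧ ∀ u : StateSpace T p E.VZ, ∀ᵐ t ∂(timeMeasure T), ∀ᵐ x ∂(domMeasure Ω),
    ∀ β : MultiIdx (Fin d) κ, |jet E u t x (some β)| ≤ c * ‖u‖

open scoped Classical in
/-- The image at time `t` of `u` under the Nemytskii operator of the scalar law `f`: the function
`x ↦ f (t, 𝒥_κ u(t,x))`, as an element of `L^{q'}(Ω)` embedded in `W`. Under uniform state space
regularity, and for continuous `f`, this function is in `L^{q'}(Ω)` for almost every `t`; the
value `0` elsewhere is immaterial. -/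
def nemytskii (E : StaticEmbeddings Ω κ p' q' V Z W) (f : (LawIdx d κ → ℝ) → ℝ)
    (u : StateSpace T p E.VZ) (t : ℝ) : W :=
  if h : MemLp (fun x => f (jet E u t x)) q' (domMeasure Ω) then E.LW h.toLp else 0

/-- The time derivative of `u` at time `t`, as an element of `W`. -/
def timeDeriv (E : StaticEmbeddings Ω κ p' q' V Z W) (u : StateSpace T p E.VZ) (t : ℝ) : W :=
  E.ZW (u.1.2 t)

/-- `u` solves `∂_t u = f(t, 𝒥_κ u)` on `(0,T)`. -/
def SolvesPDE (E : StaticEmbeddings Ω κ p' q' V Z W) (f : (LawIdx d κ → ℝ) → ℝ)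
    (u : StateSpace T p E.VZ) : Prop :=
  timeDeriv E u =ᵐ[timeMeasure T] nemytskii E f u

/-- Identifiability within the class `C` of scalar laws: laws that agree along `𝒥_κ u` are
equal. -/
def Identifiable (E : StaticEmbeddings Ω κ p' q' V Z W) (C : Set ((LawIdx d κ → ℝ) → ℝ))
    (u : StateSpace T p E.VZ) : Prop :=
  ∀ f₁ ∈ C, ∀ f₂ ∈ C, nemytskii E f₁ u =ᵐ[timeMeasure T] nemytskii E f₂ u → f₁ = f₂

/-- The objective functional
`lam ‖∂_t u - 𝔖^θ(𝒥_κ u)‖^q + mu ‖K u - y‖^r + N(u)^p + R₀(θ)`, where the norms are those of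
`L^q(0,T;W)` and `L^r(0,T;Y)`. -/
def objective {Y : Type*} [NormedAddCommGroup Y] [NormedSpace ℝ Y] {r : ℝ≥0∞} [Fact (1 ≤ r)]
    (E : StaticEmbeddings Ω κ p' q' V Z W) (q : ℝ≥0∞) (A : Architecture (LawIdx d κ)) (ε : ℝ)
    (N : Seminorm ℝ (StateSpace T p E.VZ)) (R₀ : A.paramSet ε → ℝ≥0∞)
    (lam mu : ℝ) (K : StateSpace T p E.VZ → Lp Y r (timeMeasure T)) (y : Lp Y r (timeMeasure T))
    (u : StateSpace T p E.VZ) (θ : A.paramSet ε) : ℝ≥0∞ :=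
  ENNReal.ofReal lam *
      eLpNorm (fun t => timeDeriv E u t - nemytskii E (A.eval θ.1) u t) q (timeMeasure T) ^ q.toReal
    + ENNReal.ofReal (mu * ‖K u - y‖ ^ r.toReal)
    + ENNReal.ofReal (N u ^ p.toReal) + R₀ θ

end Problem

end

end SymbolicLearning

open SymbolicLearning

namespace SymbolicLearning

/-! The argument is compactness plus uniqueness of the limit. Comparison of the minimizers with the
admissible pair (u†, θ†), whose residual vanishes, bounds the objective values uniformly in `m`.
Hence the states and the parameters stay bounded, the equation residual tends to zero because `lam m
→ ∞`, and the data misfit tends to zero because `mu m → ∞`.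

Along a further subsequence of any subsequence, the states converge weakly to some u₀ and the
parameters converge to some admissible θ₀. The measurements of these states converge both to K†u₀
and to K†u†, so u₀ = u† by injectivity. Passing to the limit in the equation shows that u† also
solves the equation with the law of θ₀. Both network laws thus agree along the jet of u†, and
identifiability makes them equal as functions. Networks depend jointly continuously on parameters
and inputs, so the laws converge locally uniformly along that subsequence. The limit law is the same
for every subsequence, hence the whole sequence of laws converges, although the parameters
themselves need not.

Three analytic facts carry this. Weak compactness of the state space
(`StateSpace.exists_weakTendsto_subseq`) rests on the duality between L^p(B) and L^q(B')
(`exists_dual_representation`), obtained from Radon–Nikodym densities along a dense sequence of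
directions. Strong convergence of the jets is an Aubin–Lions argument
(`tendsto_integral_norm_of_weakTendsto`): Ehrling's inequality reduces it to scalar functions of
time, which are primitives of their weak derivatives. The limit in the equation
(`timeDeriv_ae_eq_of_tendsto`) is taken after truncating the jets at the level given by uniform
regularity, which makes the nonlinearity bounded and continuous. -/

/-! ### Separability, reflexivity and weak sequential compactness -/

/-- A normed space with separable dual is separable. -/
lemma separableSpace_of_separableSpace_dual (E : Type*) [NormedAddCommGroup E] [NormedSpace ℝ E]
    [TopologicalSpace.SeparableSpace (E →L[ℝ] ℝ)] : TopologicalSpace.SeparableSpace E := by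
  classical
  set ξ := TopologicalSpace.denseSeq (E →L[ℝ] ℝ) with hξ
  -- Vectors of the unit ball that norm a dense sequence of functionals up to the factor 1/2. Their
  -- span is dense: a functional vanishing on it would be close to some `ξ n`, which then has to be
  -- small at `x n`.
  have hex : ∀ n, ∃ x : E, ‖x‖ ≤ 1 ∧ ‖ξ n‖ / 2 ≤ ‖ξ n x‖ := by
    intro n
    by_cases h0 : ξ n = 0
    · exact ⟨0, by simp, by simp [h0]⟩
    have hpos : 0 < ‖ξ n‖ := norm_pos_iff.2 h0
    obtain ⟨x, hx1, hx2⟩ := (ξ n).exists_lt_apply_of_lt_opNorm (half_lt_self hpos)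
    exact ⟨x, hx1.le, hx2.le⟩
  choose x hx1 hx2 using hex
  set S : Submodule ℝ E := (Submodule.span ℝ (range x)).topologicalClosure with hS
  have htop : S = ⊤ := by
    by_contra hne
    obtain ⟨v, hv⟩ : ∃ v, v ∉ S := by
      by_contra! h
      exact hne (eq_top_iff.2 fun v _ => h v)
    obtain ⟨f, c, hfc, hcv⟩ := geometric_hahn_banach_closed_point S.convex
      (Submodule.isClosed_topologicalClosure _) hv
    have hf0 : ∀ a ∈ S, f a = 0 := by
      intro a ha
      by_contra hne
      -- A functional bounded above by `c` on a subspace vanishes there: otherwise this multiple of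
      -- `a` would have the value `c + 1`.
      have h1 := hfc _ (S.smul_mem ((c + 1) / f a) ha)
      rw [map_smul, smul_eq_mul, div_mul_cancel₀ _ hne] at h1
      linarith
    have hc0 : 0 < c := by simpa using hfc 0 S.zero_mem
    have hfpos : 0 < ‖f‖ := by
      refine norm_pos_iff.2 fun h => ?_
      rw [h] at hcv
      simp at hcv
      linarith
    -- The radius is chosen for the contradiction ‖f‖ ≤ ‖ξ n‖ + ‖ξ n - f‖ ≤ 3 ‖ξ n - f‖ < ‖f‖.
    obtain ⟨n, hn⟩ := (TopologicalSpace.denseRange_denseSeq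
      (E →L[ℝ] ℝ)).exists_dist_lt f (ε := ‖f‖ / 3) (by positivity)
    rw [dist_comm, dist_eq_norm] at hn
    have hxS : x n ∈ S := Submodule.le_topologicalClosure _ (Submodule.subset_span ⟨n, rfl⟩)
    have e1 : ‖ξ n (x n)‖ ≤ ‖ξ n - f‖ := by
      have := (ξ n - f).le_opNorm (x n)
      rw [sub_apply, hf0 _ hxS, sub_zero] at this
      nlinarith [hx1 n, norm_nonneg (ξ n - f)]
    have e2 : ‖f‖ ≤ ‖ξ n‖ + ‖ξ n - f‖ := by
      rw [norm_sub_rev]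
      simpa using norm_add_le (ξ n) (f - ξ n)
    have := hx2 n
    linarith
  have hsep : TopologicalSpace.IsSeparable (S : Set E) := by
    rw [hS, Submodule.topologicalClosure_coe]
    exact ((countable_range x).isSeparable.span (R := ℝ)).closure
  rw [htop] at hsep
  exact TopologicalSpace.isSeparable_univ_iff.1 (by simpa using hsep)

/-- The dual of a separable reflexive space is separable. -/
lemma IsReflexive.separableSpace_dual {E : Type*} [NormedAddCommGroup E] [NormedSpace ℝ E]
    [TopologicalSpace.SeparableSpace E] (hE : IsReflexive E) :
    TopologicalSpace.SeparableSpace (E →L[ℝ] ℝ) := by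
  -- By reflexivity the bidual is a continuous image of `E`, so the dual of `E` is a space with
  -- separable dual.
  have : TopologicalSpace.SeparableSpace ((E →L[ℝ] ℝ) →L[ℝ] ℝ) :=
    hE.denseRange.separableSpace (NormedSpace.inclusionInDoubleDual ℝ E).continuous
  exact separableSpace_of_separableSpace_dual _

/-- Bounded sequences in a reflexive space with separable dual have weakly convergent
subsequences. -/
lemma IsReflexive.exists_weakTendsto_subseq {E : Type*} [NormedAddCommGroup E] [NormedSpace ℝ E]
    [TopologicalSpace.SeparableSpace (E →L[ℝ] ℝ)] (hE : IsReflexive E) {u : ℕ → E} {M : ℝ}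
    (hu : ∀ n, ‖u n‖ ≤ M) :
    ∃ (v : E) (φ : ℕ → ℕ), StrictMono φ ∧ WeakTendsto (u ∘ φ) v := by
  -- Sequential Banach–Alaoglu in the bidual, where separability of the dual is used; reflexivity
  -- then pulls the weak-* limit back to `E`.
  obtain ⟨Λ, -, φ, hφ, hlim⟩ := WeakDual.isSeqCompact_closedBall ℝ (E →L[ℝ] ℝ) 0 M
    (x := fun n => StrongDual.toWeakDual (NormedSpace.inclusionInDoubleDual ℝ E (u n)))
    (fun n => by
      simp only [mem_preimage, mem_closedBall_zero_iff]
      exact (NormedSpace.double_dual_bound ℝ E (u n)).trans (hu n))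
  obtain ⟨v, hv⟩ := hE (WeakDual.toStrongDual Λ)
  refine ⟨v, φ, hφ, fun l => ?_⟩
  have h1 := ((WeakDual.eval_continuous l).tendsto Λ).comp hlim
  have h2 : Λ l = l v := by
    change (WeakDual.toStrongDual Λ) l = l v
    rw [← hv]
    rfl
  rw [h2] at h1
  exact h1

lemma WeakTendsto.comp_clm {E F : Type*} [NormedAddCommGroup E] [NormedSpace ℝ E]
    [NormedAddCommGroup F] [NormedSpace ℝ F] {u : ℕ → E} {v : E} (h : WeakTendsto u v)
    (A : E →L[ℝ] F) : WeakTendsto (fun n => A (u n)) (A v) :=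
  fun l => h (l.comp A)

lemma WeakTendsto.comp_strictMono {E : Type*} [NormedAddCommGroup E] [NormedSpace ℝ E]
    {u : ℕ → E} {v : E} (h : WeakTendsto u v) {φ : ℕ → ℕ} (hφ : StrictMono φ) :
    WeakTendsto (u ∘ φ) v :=
  fun l => (h l).comp hφ.tendsto_atTop

/-! ### Measurability of functions with values in a separable dual -/

/-- Functions with values in a separable dual space that are measurable when tested with a dense
sequence are strongly measurable. -/
lemma stronglyMeasurable_of_denseRange_apply {α B : Type*} [MeasurableSpace α]
    [NormedAddCommGroup B] [NormedSpace ℝ B] [TopologicalSpace.SeparableSpace (B →L[ℝ] ℝ)]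
    {e : ℕ → B} (he : DenseRange e) {g : α → B →L[ℝ] ℝ}
    (hg : ∀ i, Measurable fun t => g t (e i)) : StronglyMeasurable g := by
  borelize (B →L[ℝ] ℝ)
  have : SecondCountableTopology (B →L[ℝ] ℝ) := UniformSpace.secondCountable_of_separable _
  -- An operator norm bound need only be tested on the dense sequence `e`, so the preimage of a
  -- closed ball is a countable intersection of measurable sets.
  have hball : ∀ (ξ : B →L[ℝ] ℝ) (r : ℝ), MeasurableSet {t | ‖g t - ξ‖ ≤ r} := by
    intro ξ r
    by_cases hr : 0 ≤ r
    · have : {t | ‖g t - ξ‖ ≤ r} = ⋂ i, {t | ‖g t (e i) - ξ (e i)‖ ≤ r * ‖e i‖} := by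
        ext t
        simp only [mem_ofPred_eq, mem_iInter]
        constructor
        · intro h i
          exact (g t - ξ).le_of_opNorm_le h (e i)
        · intro h
          refine ContinuousLinearMap.opNorm_le_bound _ hr fun v => ?_
          refine he.induction_on (p := fun v => ‖(g t - ξ) v‖ ≤ r * ‖v‖) v ?_ h
          exact isClosed_le (by fun_prop) (by fun_prop)
      rw [this]
      refine MeasurableSet.iInter fun i => measurableSet_le ?_ measurable_const
      exact ((hg i).sub_const _).norm
    · convert MeasurableSet.empty
      ext t
      simp only [mem_ofPred_eq, mem_empty_iff_false, iff_false, not_le]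
      exact (not_le.1 hr).trans_le (norm_nonneg _)
  have hdist : ∀ ξ : B →L[ℝ] ℝ, Measurable fun t => dist (g t) ξ := by
    intro ξ
    refine measurable_of_Iic fun r => ?_
    simp only [dist_eq_norm]
    exact hball ξ r
  refine Measurable.stronglyMeasurable ?_
  refine measurable_of_isOpen fun U hU => ?_
  have hD := TopologicalSpace.exists_countable_dense (B →L[ℝ] ℝ)
  obtain ⟨D, hDc, hD⟩ := hD
  -- By separability an open set is a countable union of balls with centres in `D` and rational
  -- radii.
  have : g ⁻¹' U = ⋃ p ∈ {p : (B →L[ℝ] ℝ) × ℚ | p.1 ∈ D ∧ Metric.ball p.1 (p.2 : ℝ) ⊆ U},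
      {t | dist (g t) p.1 < p.2} := by
    ext t
    simp only [mem_preimage, mem_iUnion, mem_ofPred_eq, exists_prop]
    constructor
    · intro ht
      obtain ⟨ρ, hρ, hsub⟩ := Metric.isOpen_iff.1 hU _ ht
      obtain ⟨q, hq1, hq2⟩ := exists_rat_btwn (show ρ / 4 < ρ / 2 by linarith)
      obtain ⟨ξ, hξD, hξ⟩ := hD.exists_dist_lt (g t) (show 0 < ρ / 4 by linarith)
      refine ⟨(ξ, q), ⟨hξD, fun y hy => hsub ?_⟩, hξ.trans hq1⟩
      rw [Metric.mem_ball] at hy ⊢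
      have := dist_triangle_right y (g t) ξ
      linarith
    · rintro ⟨p, ⟨-, hp⟩, ht⟩
      exact hp ht
  rw [this]
  refine MeasurableSet.biUnion ?_ fun p _ => measurableSet_lt (hdist _) measurable_const
  refine Countable.mono ?_ (hDc.prod (countable_univ (α := ℚ)))
  rintro p ⟨hp, -⟩
  exact ⟨hp, mem_univ _⟩

/-! ### Directional densities of functionals on Bochner spaces -/

section Dual

variable {α : Type*} [MeasurableSpace α] {μ : Measure α} [IsFiniteMeasure μ]
  {B : Type*} [NormedAddCommGroup B] [NormedSpace ℝ B] {p : ℝ≥0∞} [Fact (1 ≤ p)]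

open scoped Classical in
/-- The signed measure `s ↦ l (1_s v)` associated to a functional `l` on `L^p(μ;B)`. -/
noncomputable def functionalMeasure (hp : p ≠ ∞) (l : Lp B p μ →L[ℝ] ℝ) (v : B) :
    SignedMeasure α where
  measureOf' s := if hs : MeasurableSet s then
    l (indicatorConstLp p hs (measure_ne_top μ s) v) else 0
  empty' := by simp
  not_measurable' s hs := by simp [hs]
  m_iUnion' f hf hd := by
    have hU : MeasurableSet (⋃ i, f i) := MeasurableSet.iUnion hf
    have hfin : ∀ F : Finset ℕ, MeasurableSet (⋃ i ∈ F, f i) := fun F =>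
      F.measurableSet_biUnion fun i _ => hf i
    have hsum : ∀ F : Finset ℕ, ∑ i ∈ F, indicatorConstLp p (hf i) (measure_ne_top μ _) v =
        indicatorConstLp p (hfin F) (measure_ne_top μ _) v := by
      intro F
      induction F using Finset.induction_on with
      | empty => simp
      | insert a F ha ih =>
        have hdis : Disjoint (f a) (⋃ i ∈ F, f i) := by
          refine disjoint_iUnion₂_right.2 fun i hi => hd ?_
          rintro rfl
          exact ha hi
        rw [Finset.sum_insert ha, ih, ← indicatorConstLp_disjoint_union _ _ _ _ hdis]
        congr 1
        simp
    -- Countable additivity: the measure of the tail tends to zero, and for `p ≠ ∞` this forces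
    -- convergence of the indicators in L^p.
    have htend : Tendsto (fun F : Finset ℕ => indicatorConstLp p (hfin F) (measure_ne_top μ _) v)
        atTop (𝓝 (indicatorConstLp p hU (measure_ne_top μ _) v)) := by
      refine tendsto_indicatorConstLp_set hp ?_
      have h0 := ENNReal.tendsto_tsum_compl_atTop_zero (f := fun i => μ (f i))
        (by rw [← measure_iUnion hd hf]; exact measure_ne_top _ _)
      refine tendsto_of_tendsto_of_tendsto_of_le_of_le tendsto_const_nhds h0
        (fun _ => zero_le) fun F => ?_
      refine (measure_mono ?_).trans (measure_iUnion_le _)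
      intro x hx
      rcases hx with ⟨hx1, hx2⟩ | ⟨hx1, hx2⟩
      · obtain ⟨i, hi, hxi⟩ := mem_iUnion₂.1 hx1
        exact (hx2 (mem_iUnion.2 ⟨i, hxi⟩)).elim
      · obtain ⟨i, hi⟩ := mem_iUnion.1 hx1
        exact mem_iUnion.2 ⟨⟨i, fun hF => hx2 (mem_iUnion₂.2 ⟨i, hF, hi⟩)⟩, hi⟩
    simp only [hf, hU, dif_pos]
    have := (l.continuous.tendsto _).comp htend
    refine this.congr fun F => ?_
    simp only [Function.comp_apply, ← hsum, map_sum]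

lemma functionalMeasure_apply (hp : p ≠ ∞) (l : Lp B p μ →L[ℝ] ℝ) (v : B) {s : Set α}
    (hs : MeasurableSet s) :
    functionalMeasure hp l v s = l (indicatorConstLp p hs (measure_ne_top μ s) v) := by
  classical
  change (if hs : MeasurableSet s then _ else _) = _
  rw [dif_pos hs]

/-- Functionals on `L^p(μ;B)` have densities in every direction `v ∈ B`. -/
lemma exists_density (hp : p ≠ ∞) (l : Lp B p μ →L[ℝ] ℝ) (v : B) :
    ∃ ψ : α → ℝ, Measurable ψ ∧ Integrable ψ μ ∧ ∀ (s : Set α) (hs : MeasurableSet s),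
      l (indicatorConstLp p hs (measure_ne_top μ s) v) = ∫ t in s, ψ t ∂μ := by
  -- Indicators of null sets vanish in L^p, so Radon–Nikodym applies.
  have hac : functionalMeasure hp l v ≪ᵥ μ.toENNRealVectorMeasure := by
    refine VectorMeasure.AbsolutelyContinuous.mk fun s hs h0 => ?_
    rw [Measure.toENNRealVectorMeasure_apply_measurable hs] at h0
    rw [functionalMeasure_apply hp l v hs]
    have : indicatorConstLp p hs (measure_ne_top μ s) v = 0 := by
      rw [← norm_eq_zero]
      have hp0 : p ≠ 0 := (zero_lt_one.trans_le Fact.out).ne'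
      rw [norm_indicatorConstLp hp0 hp, measureReal_def, h0, ENNReal.toReal_zero, Real.zero_rpow,
        mul_zero]
      exact one_div_ne_zero (ENNReal.toReal_pos hp0 hp).ne'
    rw [this, map_zero]
  refine ⟨(functionalMeasure hp l v).rnDeriv μ, SignedMeasure.measurable_rnDeriv _ _,
    SignedMeasure.integrable_rnDeriv _ _, fun s hs => ?_⟩
  have h1 := SignedMeasure.withDensityᵥ_rnDeriv_eq _ μ hac
  rw [← functionalMeasure_apply hp l v hs,
    ← withDensityᵥ_apply (SignedMeasure.integrable_rnDeriv _ _) hs, h1]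

variable {d : ℕ → B} {ψ : ℕ → α → ℝ}

/-- Densities in the directions `d i` determine the functional on simple functions with values
in the span of the `d i`. -/
lemma simpleFunc_density (l : Lp B p μ →L[ℝ] ℝ) (hψm : ∀ i, Measurable (ψ i))
    (hψi : ∀ i, Integrable (ψ i) μ)
    (hψ : ∀ i (s : Set α) (hs : MeasurableSet s),
      l (indicatorConstLp p hs (measure_ne_top μ s) (d i)) = ∫ t in s, ψ i t ∂μ)
    (S : SimpleFunc α (ℕ →₀ ℝ)) :
    Measurable (fun t => Finsupp.linearCombination ℝ (fun i => ψ i t) (S t)) ∧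
    Integrable (fun t => Finsupp.linearCombination ℝ (fun i => ψ i t) (S t)) μ ∧
    ∀ h : MemLp (fun t => Finsupp.linearCombination ℝ d (S t)) p μ,
      l h.toLp = ∫ t, Finsupp.linearCombination ℝ (fun i => ψ i t) (S t) ∂μ := by
  -- Values are kept as coefficient vectors and not as elements of `B`: at a fixed `t` the
  -- assignment `d i ↦ ψ i t` need not respect the linear relations among the `d i`.
  have hc : ∀ c : ℕ →₀ ℝ,
      Measurable (fun t => Finsupp.linearCombination ℝ (fun i => ψ i t) c) ∧
      Integrable (fun t => Finsupp.linearCombination ℝ (fun i => ψ i t) c) μ ∧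
      ∀ (s : Set α) (hs : MeasurableSet s),
        l (indicatorConstLp p hs (measure_ne_top μ s) (Finsupp.linearCombination ℝ d c)) =
          ∫ t in s, Finsupp.linearCombination ℝ (fun i => ψ i t) c ∂μ := by
    intro c
    induction c using Finsupp.induction_linear with
    | zero => simp [indicatorConstLp]
    | add f g hf hg =>
      simp only [map_add]
      refine ⟨hf.1.add hg.1, hf.2.1.add hg.2.1, fun s hs => ?_⟩
      rw [← indicatorConstLp_add, map_add, hf.2.2, hg.2.2,
        integral_add hf.2.1.integrableOn hg.2.1.integrableOn]
    | single i a =>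
      simp only [Finsupp.linearCombination_single, smul_eq_mul]
      refine ⟨(hψm i).const_mul a, (hψi i).const_mul a, fun s hs => ?_⟩
      rw [integral_const_mul, ← hψ i s hs, ← smul_eq_mul, ← map_smul]
      congr 1
      rw [indicatorConstLp, indicatorConstLp, ← MemLp.toLp_const_smul]
      exact MemLp.toLp_congr _ _ (Eventually.of_forall fun t => by
        by_cases ht : t ∈ s <;> simp [ht])
  have hmem : ∀ S : SimpleFunc α (ℕ →₀ ℝ),
      MemLp (fun t => Finsupp.linearCombination ℝ d (S t)) p μ := fun S =>
    (S.map (Finsupp.linearCombination ℝ d)).memLp_of_isFiniteMeasure p μ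
  induction S using SimpleFunc.induction with
  | const c hs =>
    rename_i s
    have e1 : ∀ t, Finsupp.linearCombination ℝ (fun i => ψ i t)
        ((SimpleFunc.piecewise s hs (SimpleFunc.const α c) (SimpleFunc.const α 0)) t) =
        s.indicator (fun t => Finsupp.linearCombination ℝ (fun i => ψ i t) c) t := by
      intro t
      by_cases ht : t ∈ s <;> simp [ht]
    simp only [e1]
    refine ⟨(hc c).1.indicator hs, (hc c).2.1.indicator hs, fun h => ?_⟩
    rw [integral_indicator hs, ← (hc c).2.2 s hs]
    congr 1
    refine MemLp.toLp_congr _ _ (Eventually.of_forall fun t => ?_)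
    by_cases ht : t ∈ s <;> simp [ht]
  | add hd hf hg =>
    rename_i f g
    simp only [SimpleFunc.coe_add, Pi.add_apply, map_add]
    refine ⟨hf.1.add hg.1, hf.2.1.add hg.2.1, fun h => ?_⟩
    rw [integral_add hf.2.1 hg.2.1, ← hf.2.2 (hmem f), ← hg.2.2 (hmem g), ← map_add,
      ← MemLp.toLp_add]
    rfl

/-- Measurable selection of the largest of finitely many directional densities. -/
lemma exists_simpleFunc_selection (l : Lp B p μ →L[ℝ] ℝ) (hψm : ∀ i, Measurable (ψ i))
    (hψi : ∀ i, Integrable (ψ i) μ)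
    (hψ : ∀ i (s : Set α) (hs : MeasurableSet s),
      l (indicatorConstLp p hs (measure_ne_top μ s) (d i)) = ∫ t in s, ψ i t ∂μ)
    {b : ℕ → ℕ →₀ ℝ} (hb : ∀ k, ‖Finsupp.linearCombination ℝ d (b k)‖ ≤ 1) (K : ℕ) :
    ∃ σ : SimpleFunc α (ℕ →₀ ℝ), (∀ t, ‖Finsupp.linearCombination ℝ d (σ t)‖ ≤ 1) ∧
      ∀ t, 0 ≤ Finsupp.linearCombination ℝ (fun i => ψ i t) (σ t) ∧
        ∀ k < K, Finsupp.linearCombination ℝ (fun i => ψ i t) (b k) ≤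
          Finsupp.linearCombination ℝ (fun i => ψ i t) (σ t) := by
  induction K with
  | zero => exact ⟨SimpleFunc.const α 0, by simp, by simp⟩
  | succ K ih =>
    obtain ⟨σ, h1, h2⟩ := ih
    have hm : ∀ S : SimpleFunc α (ℕ →₀ ℝ),
        Measurable (fun t => Finsupp.linearCombination ℝ (fun i => ψ i t) (S t)) :=
      fun S => (simpleFunc_density l hψm hψi hψ S).1
    -- The selection is switched to `b K` exactly where it beats the current choice. The induction
    -- starts from the zero vector, which keeps the selected density nonnegative.
    have hs : MeasurableSet {t | Finsupp.linearCombination ℝ (fun i => ψ i t) (σ t) <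
        Finsupp.linearCombination ℝ (fun i => ψ i t) (b K)} :=
      measurableSet_lt (hm σ) (hm (SimpleFunc.const α (b K)))
    set A := {t | Finsupp.linearCombination ℝ (fun i => ψ i t) (σ t) <
        Finsupp.linearCombination ℝ (fun i => ψ i t) (b K)} with hA
    refine ⟨SimpleFunc.piecewise A hs (SimpleFunc.const α (b K)) σ, fun t => ?_, fun t => ?_⟩
    · by_cases ht : t ∈ A
      · simpa [ht] using hb K
      · simpa [ht] using h1 t
    · by_cases ht : t ∈ A
      · have ht' : Finsupp.linearCombination ℝ (fun i => ψ i t) (σ t) <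
          Finsupp.linearCombination ℝ (fun i => ψ i t) (b K) := ht
        have e : (SimpleFunc.piecewise A hs (SimpleFunc.const α (b K)) σ) t = b K := by simp [ht]
        rw [e]
        refine ⟨(h2 t).1.trans ht'.le, fun k hk => ?_⟩
        rcases Nat.lt_succ_iff_lt_or_eq.1 hk with hk | rfl
        · exact ((h2 t).2 k hk).trans ht'.le
        · exact le_rfl
      · have e : (SimpleFunc.piecewise A hs (SimpleFunc.const α (b K)) σ) t = σ t := by simp [ht]
        rw [e]
        refine ⟨(h2 t).1, fun k hk => ?_⟩
        rcases Nat.lt_succ_iff_lt_or_eq.1 hk with hk | rfl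
        · exact (h2 t).2 k hk
        · exact not_lt.1 ht

/-- The density of a functional on `L^p` in a direction chosen in the unit ball is bounded in the
conjugate space by the norm of the functional. -/
lemma lintegral_density_rpow_le (hp : p ≠ ∞) {q : ℝ} (hpq : p.toReal.HolderConjugate q)
    (l : Lp B p μ →L[ℝ] ℝ) (hψm : ∀ i, Measurable (ψ i))
    (hψi : ∀ i, Integrable (ψ i) μ)
    (hψ : ∀ i (s : Set α) (hs : MeasurableSet s),
      l (indicatorConstLp p hs (measure_ne_top μ s) (d i)) = ∫ t in s, ψ i t ∂μ)
    (σ : SimpleFunc α (ℕ →₀ ℝ)) (hσ : ∀ t, ‖Finsupp.linearCombination ℝ d (σ t)‖ ≤ 1)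
    (hσ0 : ∀ t, 0 ≤ Finsupp.linearCombination ℝ (fun i => ψ i t) (σ t)) :
    ∫⁻ t, ENNReal.ofReal (Finsupp.linearCombination ℝ (fun i => ψ i t) (σ t)) ^ q ∂μ ≤
      ‖l‖ₑ ^ q := by
  have hp0 : p ≠ 0 := (zero_lt_one.trans_le Fact.out).ne'
  set F : α → ℝ≥0∞ :=
    fun t => ENNReal.ofReal (Finsupp.linearCombination ℝ (fun i => ψ i t) (σ t)) with hF
  -- Simple minorants `φ` of `F ^ q` have a finite integral `I`, which can be cancelled in `I ≤ ‖l‖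
  -- * I ^ (1 / p)`; finiteness of the integral of `F ^ q` itself is not known beforehand.
  rw [lintegral_eq_nnreal]
  refine iSup₂_le fun φ hφ => ?_
  set I := (φ.map ENNReal.ofNNReal).lintegral μ with hI
  have hIint : I = ∫⁻ t, (φ t : ℝ≥0∞) ∂μ := by
    rw [hI, ← SimpleFunc.lintegral_eq_lintegral]; rfl
  have hIfin : I ≠ ∞ := by
    rw [hIint]
    obtain ⟨C, hC⟩ := φ.exists_forall_le
    refine ((lintegral_mono (g := fun _ => (C : ℝ≥0∞)) fun t =>
      ENNReal.coe_le_coe.2 (hC t)).trans_lt ?_).ne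
    rw [lintegral_const]
    exact ENNReal.mul_lt_top ENNReal.coe_lt_top (measure_lt_top _ _)
  -- The extremal test function of Hölder's inequality: the selected direction scaled by `φ ^ (1 /
  -- p)`. Its L^p norm is at most `I ^ (1 / p)`, and since `φ ^ (1 / q) ≤ F` its image under `l` is
  -- at least the integral of `φ ^ (1 / p) * φ ^ (1 / q) = φ`.
  set S : SimpleFunc α (ℕ →₀ ℝ) :=
    (φ.pair σ).map (fun z => ((z.1 : ℝ) ^ (1 / p.toReal)) • z.2) with hS
  have hSt : ∀ t, S t = ((φ t : ℝ) ^ (1 / p.toReal)) • σ t := fun t => rfl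
  obtain ⟨hSm, hSi, hSl⟩ := simpleFunc_density l hψm hψi hψ S
  have hmem : MemLp (fun t => Finsupp.linearCombination ℝ d (S t)) p μ :=
    (S.map (Finsupp.linearCombination ℝ d)).memLp_of_isFiniteMeasure p μ
  have hnorm : ‖hmem.toLp‖ₑ ≤ I ^ (1 / p.toReal) := by
    rw [Lp.enorm_toLp, eLpNorm_eq_lintegral_rpow_enorm_toReal hp0 hp, hIint]
    refine ENNReal.rpow_le_rpow (lintegral_mono fun t => ?_) (by positivity)
    rw [hSt, map_smul, enorm_smul]
    calc (‖(φ t : ℝ) ^ (1 / p.toReal)‖ₑ * ‖Finsupp.linearCombination ℝ d (σ t)‖ₑ) ^ p.toReal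
        ≤ ((φ t : ℝ≥0∞) ^ (1 / p.toReal) * 1) ^ p.toReal := by
          gcongr
          · rw [Real.enorm_of_nonneg (by positivity),
              ← ENNReal.ofReal_rpow_of_nonneg (by positivity) (by positivity)]
            simp
          · rw [← ofReal_norm]
            exact ENNReal.ofReal_le_one.2 (hσ t)
      _ = φ t := by
          rw [mul_one, one_div, ENNReal.rpow_inv_rpow hpq.pos.ne']
  have hlow : I ≤ ‖l hmem.toLp‖ₑ := by
    rw [hSl hmem, hIint]
    have hnn : ∀ t, 0 ≤ Finsupp.linearCombination ℝ (fun i => ψ i t) (S t) := fun t => by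
      rw [hSt, map_smul, smul_eq_mul]
      exact mul_nonneg (by positivity) (hσ0 t)
    rw [Real.enorm_of_nonneg (integral_nonneg hnn),
      ofReal_integral_eq_lintegral_ofReal hSi (Eventually.of_forall hnn)]
    refine lintegral_mono fun t => ?_
    have h3 : (φ t : ℝ≥0∞) ^ (1 / q) ≤ F t := by
      rw [one_div, ENNReal.rpow_inv_le_iff hpq.symm.pos]
      exact hφ t
    simp only [hSt, map_smul, smul_eq_mul]
    rw [ENNReal.ofReal_mul (by positivity)]
    calc (φ t : ℝ≥0∞) = (φ t : ℝ≥0∞) ^ (1 / p.toReal) * (φ t : ℝ≥0∞) ^ (1 / q) := by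
          rw [← ENNReal.rpow_add_of_nonneg _ _ (by have := hpq.pos; positivity)
            (by have := hpq.symm.pos; positivity), one_div, one_div, hpq.inv_add_inv_eq_one,
            ENNReal.rpow_one]
      _ ≤ _ := by
          gcongr
          rw [← ENNReal.ofReal_rpow_of_nonneg (by positivity) (by positivity)]
          simp
  have hmain : I ≤ ‖l‖ₑ * I ^ (1 / p.toReal) :=
    hlow.trans ((l.le_opENorm _).trans (by gcongr))
  rcases eq_or_ne I 0 with h0 | h0
  · rw [h0]; exact zero_le
  have h4 : I ^ (1 / q) ≤ ‖l‖ₑ := by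
    have : I = I ^ (1 / q) * I ^ (1 / p.toReal) := by
      rw [← ENNReal.rpow_add _ _ h0 hIfin, one_div, one_div, hpq.symm.inv_add_inv_eq_one,
        ENNReal.rpow_one]
    refine (ENNReal.mul_le_mul_iff_left (c := I ^ (1 / p.toReal)) ?_ ?_).1 (this ▸ hmain)
    · exact (ENNReal.rpow_pos (pos_iff_ne_zero.2 h0) hIfin).ne'
    · exact ENNReal.rpow_ne_top_of_nonneg (by positivity) hIfin
  rw [one_div, ENNReal.rpow_inv_le_iff hpq.symm.pos] at h4
  exact h4

end Dual

/-! ### Extension of functionals from rational combinations -/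

section Extension

lemma linearCombination_mapRange_indicator {F : Type*} [AddCommGroup F] [Module ℝ F] (v : ℕ → F)
    (s : Finset ℕ) (z : ℕ → ℚ) :
    Finsupp.linearCombination ℝ v ((Finsupp.indicator s fun i _ => z i).mapRange
      (fun x : ℚ => (x : ℝ)) (by simp)) = ∑ i ∈ s, (z i : ℝ) • v i := by
  rw [Finsupp.linearCombination_apply, Finsupp.sum_of_support_subset (s := s)]
  · refine Finset.sum_congr rfl fun i hi => ?_
    simp [Finsupp.indicator_of_mem hi]
  · exact Finsupp.support_mapRange.trans (Finsupp.support_indicator_subset _ _)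
  · simp

variable {B : Type*} [NormedAddCommGroup B] [NormedSpace ℝ B]

/-- A family of values on a dense sequence that is dominated on rational combinations extends to
a continuous functional. -/
lemma exists_extension_of_rat_bound {d : ℕ → B} (hd : DenseRange d) {ψ : ℕ → ℝ} {M : ℝ}
    (hM : 0 ≤ M)
    (h : ∀ c : ℕ →₀ ℚ, |Finsupp.linearCombination ℝ ψ (c.mapRange (fun x : ℚ => (x : ℝ)) (by simp))| ≤
      M * ‖Finsupp.linearCombination ℝ d (c.mapRange (fun x : ℚ => (x : ℝ)) (by simp))‖) :
    ∃ g : B →L[ℝ] ℝ, (∀ i, g (d i) = ψ i) ∧ ‖g‖ ≤ M := by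
  have hreal : ∀ x : ℕ →₀ ℝ, ‖Finsupp.linearCombination ℝ ψ x‖ ≤
      M * ‖Finsupp.linearCombination ℝ d x‖ := by
    intro x
    have key : ∀ y : ℕ → ℝ, ‖∑ i ∈ x.support, y i • ψ i‖ ≤ M * ‖∑ i ∈ x.support, y i • d i‖ := by
      intro y
      -- For a fixed support both sides are continuous in the coefficients, so rational coefficients
      -- suffice.
      have hdense : DenseRange (Pi.map fun (_ : ℕ) (z : ℚ) => (z : ℝ)) :=
        DenseRange.piMap fun _ => Rat.denseRange_cast
      refine hdense.induction_on (p := fun y : ℕ → ℝ =>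
        ‖∑ i ∈ x.support, y i • ψ i‖ ≤ M * ‖∑ i ∈ x.support, y i • d i‖) y ?_ ?_
      · exact isClosed_le (by fun_prop) (by fun_prop)
      · intro z
        have hz := h (Finsupp.indicator x.support fun i _ => z i)
        rw [linearCombination_mapRange_indicator, linearCombination_mapRange_indicator,
          ← Real.norm_eq_abs] at hz
        exact hz
    simpa [Finsupp.linearCombination_apply, Finsupp.sum] using key x
  have hdense : DenseRange (Finsupp.linearCombination ℝ d) :=
    hd.mono (by
      rintro _ ⟨i, rfl⟩
      exact ⟨Finsupp.single i 1, by simp⟩)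
  -- The bound also makes the extension well defined: coefficient vectors whose combination of the
  -- `d i` vanishes have a vanishing combination of the `ψ i`.
  refine ⟨(Finsupp.linearCombination ℝ ψ).extendOfNorm (Finsupp.linearCombination ℝ d),
    fun i => ?_, LinearMap.opNorm_extendOfNorm_le hdense hM hreal⟩
  have := LinearMap.extendOfNorm_eq hdense ⟨M, hreal⟩ (Finsupp.single i 1)
  simpa using this

end Extension

/-! ### The dual of a Bochner space -/

section Dual

lemma continuous_indicatorConstLp {α : Type*} [MeasurableSpace α] {μ : Measure α}
    [IsFiniteMeasure μ] {B : Type*} [NormedAddCommGroup B] {p : ℝ≥0∞} [Fact (1 ≤ p)]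
    {s : Set α} (hs : MeasurableSet s) :
    Continuous fun v : B => indicatorConstLp p hs (measure_ne_top μ s) v := by
  refine (LipschitzWith.of_dist_le_mul (K := (μ.real s ^ (1 / p.toReal)).toNNReal)
    fun v w => ?_).continuous
  rw [dist_eq_norm, dist_eq_norm, indicatorConstLp_sub, Real.coe_toNNReal _ (by positivity),
    mul_comm]
  exact norm_indicatorConstLp_le

variable {α : Type*} [MeasurableSpace α] {μ : Measure α} [IsFiniteMeasure μ]
  {B : Type*} [NormedAddCommGroup B] [NormedSpace ℝ B] {p q : ℝ≥0∞} [Fact (1 ≤ p)] [Fact (1 ≤ q)]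

/-- The dual of `L^p(μ;B)` is `L^q(μ;B')` when `B` and its dual `B'` are separable. -/
theorem exists_dual_representation [TopologicalSpace.SeparableSpace B]
    [TopologicalSpace.SeparableSpace (B →L[ℝ] ℝ)] [p.HolderConjugate q] (hp : p ≠ ∞) (hq : q ≠ ∞)
    (l : Lp B p μ →L[ℝ] ℝ) :
    ∃ g : Lp (B →L[ℝ] ℝ) q μ, ∀ f : Lp B p μ, l f = ∫ t, g t (f t) ∂μ := by
  have hpq : p.toReal.HolderConjugate q.toReal :=
    ENNReal.HolderConjugate.toReal_of_ne_top hp hq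
  have : q.HolderConjugate p := ENNReal.HolderConjugate.symm
  set d := TopologicalSpace.denseSeq B with hd
  have hdd : DenseRange d := TopologicalSpace.denseRange_denseSeq B
  -- The representing function must satisfy `g t (d i) = ψ i t`. The pointwise bound needed to build
  -- `g t` is `Ψ t`, the supremum of the densities over countably many combinations in the unit
  -- ball; it is finite almost everywhere because its L^q norm is at most ‖l‖.
  choose ψ hψm hψi hψ using fun i => exists_density hp l (d i)
  obtain ⟨en, hen⟩ := exists_surjective_nat ((ℕ →₀ ℚ) × ℕ)
  set rc : (ℕ →₀ ℚ) → ℕ →₀ ℝ := fun c => c.mapRange (fun x : ℚ => (x : ℝ)) (by simp) with hrc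
  -- The summand `1 / (n + 1)` allows normalization even when the combination of the `d i` is zero;
  -- `n → ∞` later recovers the bound by the norm alone.
  set b : ℕ → ℕ →₀ ℝ := fun k =>
    (‖Finsupp.linearCombination ℝ d (rc (en k).1)‖ + 1 / ((en k).2 + 1 : ℝ))⁻¹ • rc (en k).1 with hb
  have hb1 : ∀ k, ‖Finsupp.linearCombination ℝ d (b k)‖ ≤ 1 := by
    intro k
    have h1 : (0 : ℝ) < 1 / ((en k).2 + 1 : ℝ) := by positivity
    simp only [hb, map_smul, norm_smul, norm_inv]
    rw [Real.norm_of_nonneg (by positivity), inv_mul_le_iff₀ (by positivity)]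
    linarith
  set a : ℕ → α → ℝ≥0∞ := fun k t =>
    ENNReal.ofReal (Finsupp.linearCombination ℝ (fun i => ψ i t) (b k)) with ha
  have ham : ∀ k, Measurable (a k) := fun k =>
    ((simpleFunc_density l hψm hψi hψ (SimpleFunc.const α (b k))).1).ennreal_ofReal
  set Ψ : α → ℝ≥0∞ := fun t => ⨆ k, a k t with hΨ
  have hΨm : Measurable Ψ := Measurable.iSup ham
  have hΨint : ∫⁻ t, Ψ t ^ q.toReal ∂μ ≤ ‖l‖ₑ ^ q.toReal := by
    -- Finite suprema are dominated by the density of one measurable selection, and monotone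
    -- convergence passes to the full supremum.
    have e : ∀ t, Ψ t ^ q.toReal = ⨆ K : ℕ, (⨆ k, ⨆ (_ : k < K), a k t) ^ q.toReal := by
      intro t
      have h1 : Ψ t = ⨆ K : ℕ, ⨆ k, ⨆ (_ : k < K), a k t := by
        refine le_antisymm (iSup_le fun k => ?_) (iSup_le fun K => iSup₂_le fun k _ => ?_)
        · exact le_iSup_of_le (k + 1) (le_iSup₂_of_le k (Nat.lt_succ_self k) le_rfl)
        · exact le_iSup (fun k => a k t) k
      rw [h1]
      exact (ENNReal.orderIsoRpow q.toReal hpq.symm.pos).map_iSup _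
    simp_rw [e]
    rw [lintegral_iSup]
    · refine iSup_le fun K => ?_
      obtain ⟨σ, hσ1, hσ2⟩ := exists_simpleFunc_selection l hψm hψi hψ hb1 K
      refine le_trans (lintegral_mono fun t => ?_)
        (lintegral_density_rpow_le hp hpq l hψm hψi hψ σ hσ1 fun t => (hσ2 t).1)
      refine ENNReal.rpow_le_rpow (iSup₂_le fun k hk => ?_) hpq.symm.pos.le
      exact ENNReal.ofReal_le_ofReal ((hσ2 t).2 k hk)
    · intro K
      exact (Measurable.iSup fun k => Measurable.iSup_Prop _ (ham k)).pow_const _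
    · intro K K' hK t
      exact ENNReal.rpow_le_rpow (iSup₂_le fun k hk => le_iSup₂_of_le k (hk.trans_le hK) le_rfl)
        hpq.symm.pos.le
  have hlfin : ‖l‖ₑ ^ q.toReal < ∞ := by
    refine ENNReal.rpow_lt_top_of_nonneg hpq.symm.pos.le (by simp)
  have hae : ∀ᵐ t ∂μ, Ψ t < ∞ := by
    filter_upwards [ae_lt_top (hΨm.pow_const q.toReal) (hΨint.trans_lt hlfin).ne] with t ht
    rwa [ENNReal.rpow_lt_top_iff_of_pos hpq.symm.pos] at ht
  -- Where `Ψ` is infinite, which is a null set, the functional is set to zero; the indicator keeps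
  -- `t ↦ g t (d i)` measurable.
  have hext : ∀ t, ∃ g : B →L[ℝ] ℝ, (∀ i, g (d i) = {t | Ψ t < ∞}.indicator (ψ i) t) ∧
      ‖g‖ₑ ≤ Ψ t := by
    intro t
    by_cases ht : Ψ t < ∞
    · obtain ⟨g, hg1, hg2⟩ := exists_extension_of_rat_bound (ψ := fun i => ψ i t) hdd
        (ENNReal.toReal_nonneg (a := Ψ t)) (fun c => by
          have hone : ∀ c : ℕ →₀ ℚ, Finsupp.linearCombination ℝ (fun i => ψ i t) (rc c) ≤
              (Ψ t).toReal * ‖Finsupp.linearCombination ℝ d (rc c)‖ := by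
            intro c
            have h1 : ∀ n : ℕ, Finsupp.linearCombination ℝ (fun i => ψ i t) (rc c) ≤
                (Ψ t).toReal * (‖Finsupp.linearCombination ℝ d (rc c)‖ + 1 / ((n : ℝ) + 1)) := by
              intro n
              obtain ⟨k, hk⟩ := hen (c, n)
              have h2 : a k t ≤ Ψ t := le_iSup (fun k => a k t) k
              have h3 := (ENNReal.ofReal_le_iff_le_toReal ht.ne).1 h2
              have hpos : (0 : ℝ) < ‖Finsupp.linearCombination ℝ d (rc c)‖ + 1 / ((n : ℝ) + 1) := by
                positivity
              simp only [hb, hk, map_smul, smul_eq_mul] at h3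
              rwa [inv_mul_le_iff₀ hpos, mul_comm] at h3
            have h4 : Tendsto (fun n : ℕ => (Ψ t).toReal *
                (‖Finsupp.linearCombination ℝ d (rc c)‖ + 1 / ((n : ℝ) + 1))) atTop
                (𝓝 ((Ψ t).toReal * (‖Finsupp.linearCombination ℝ d (rc c)‖ + 0))) :=
              (tendsto_const_nhds.add tendsto_one_div_add_atTop_nhds_zero_nat).const_mul _
            rw [add_zero] at h4
            exact ge_of_tendsto' h4 h1
          have hneg : rc (-c) = -rc c := by
            ext i
            simp [hrc]
          refine abs_le'.2 ⟨hone c, ?_⟩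
          have := hone (-c)
          rwa [hneg, map_neg, map_neg, norm_neg] at this)
      refine ⟨g, fun i => by rw [hg1, indicator_of_mem (show t ∈ {t | Ψ t < ∞} from ht)], ?_⟩
      rw [← ofReal_norm]
      exact ENNReal.ofReal_le_of_le_toReal hg2
    · exact ⟨0, fun i => by
        rw [indicator_of_notMem (show t ∉ {t | Ψ t < ∞} from ht), zero_apply],
        by rw [← ofReal_norm, norm_zero, ENNReal.ofReal_zero]; exact zero_le⟩
  choose g hg1 hg2 using hext
  have hgm : StronglyMeasurable g := by
    refine stronglyMeasurable_of_denseRange_apply hdd fun i => ?_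
    simp only [hg1]
    exact (hψm i).indicator (measurableSet_lt hΨm measurable_const)
  have hq0 : q ≠ 0 := (zero_lt_one.trans_le Fact.out).ne'
  have hgL : MemLp g q μ := by
    refine ⟨hgm.aestronglyMeasurable, ?_⟩
    rw [eLpNorm_lt_top_iff_lintegral_rpow_enorm_lt_top hq0 hq]
    exact (lintegral_mono fun t => ENNReal.rpow_le_rpow (hg2 t) hpq.symm.pos.le).trans_lt
      (hΨint.trans_lt hlfin)
  refine ⟨hgL.toLp, fun f => ?_⟩
  set P : Lp B p μ →L[ℝ] ℝ :=
    (ContinuousLinearMap.id ℝ (B →L[ℝ] ℝ)).lpPairing μ q p hgL.toLp with hP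
  have hPe : ∀ f : Lp B p μ, P f = ∫ t, g t (f t) ∂μ := by
    intro f
    rw [hP, ContinuousLinearMap.lpPairing_eq_integral]
    refine integral_congr_ae ?_
    filter_upwards [hgL.coeFn_toLp] with t ht
    simp [ht]
  -- Both functionals are continuous in `v`, so the directions `d i` suffice. Agreement on
  -- indicators then propagates to all of L^p by density of simple functions.
  have hind : ∀ (s : Set α) (hs : MeasurableSet s) (v : B),
      l (indicatorConstLp p hs (measure_ne_top μ s) v) =
        P (indicatorConstLp p hs (measure_ne_top μ s) v) := by
    intro s hs v
    refine hdd.induction_on (p := fun v => l (indicatorConstLp p hs (measure_ne_top μ s) v) =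
        P (indicatorConstLp p hs (measure_ne_top μ s) v)) v ?_ fun i => ?_
    · exact isClosed_eq (l.continuous.comp (continuous_indicatorConstLp hs))
        (P.continuous.comp (continuous_indicatorConstLp hs))
    · rw [hψ i s hs, hPe, ← integral_indicator hs]
      refine integral_congr_ae ?_
      filter_upwards [indicatorConstLp_coeFn (p := p) (hs := hs) (hμs := measure_ne_top μ s)
        (c := d i), hae] with t ht htΨ
      rw [ht]
      by_cases hts : t ∈ s
      · rw [indicator_of_mem hts, indicator_of_mem hts, hg1,
          indicator_of_mem (show t ∈ {t | Ψ t < ∞} from htΨ)]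
      · rw [indicator_of_notMem hts, indicator_of_notMem hts, map_zero]
  have heq : l f = P f := by
    refine Lp.induction hp (fun f => l f = P f) ?_ ?_ ?_ f
    · intro c s hs _
      exact hind s hs c
    · intro f g _ _ _ h1 h2
      rw [map_add, map_add, h1, h2]
    · exact isClosed_eq l.continuous P.continuous
  rw [heq, hP, ContinuousLinearMap.lpPairing_eq_integral]
  rfl

end Dual

/-! ### Reflexivity of Bochner spaces -/

section LpReflexive

variable {α : Type*} [MeasurableSpace α] {μ : Measure α} [IsFiniteMeasure μ]
  {V : Type*} [NormedAddCommGroup V] [NormedSpace ℝ V] 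

/-- Bochner spaces over separable reflexive spaces are reflexive. -/
theorem IsReflexive.lp [CompleteSpace V] [TopologicalSpace.SeparableSpace V]
    (hV : IsReflexive V) {p : ℝ≥0∞} [Fact (1 ≤ p)] (hp1 : 1 < p) (hp : p ≠ ∞) :
    IsReflexive (Lp V p μ) := by
  have := hV.separableSpace_dual
  set q := ENNReal.conjExponent p with hq
  have hpq : p.HolderConjugate q := ENNReal.HolderConjugate.conjExponent hp1.le
  have hqp : q.HolderConjugate p := hpq.symm
  have : Fact (1 ≤ q) := ⟨ENNReal.HolderConjugate.one_le q p⟩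
  have hqt : q ≠ ∞ := (ENNReal.HolderConjugate.ne_top_iff_ne_one q p).2 hp1.ne'
  have : TopologicalSpace.SeparableSpace ((V →L[ℝ] ℝ) →L[ℝ] ℝ) :=
    hV.denseRange.separableSpace (NormedSpace.inclusionInDoubleDual ℝ V).continuous
  intro Λ
  set P : Lp (V →L[ℝ] ℝ) q μ →L[ℝ] (Lp V p μ →L[ℝ] ℝ) :=
    (ContinuousLinearMap.id ℝ (V →L[ℝ] ℝ)).lpPairing μ q p with hP
  -- Through `P`, the functional `Λ` acts on L^q with values in the dual of `V`. The representation
  -- theorem for that space yields `G` in L^p with values in the bidual, and reflexivity of `V`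
  -- turns `G` into the required element of L^p.
  obtain ⟨G, hG⟩ := exists_dual_representation (p := q) (q := p) hqt hp (Λ.comp P)
  set e : V ≃ₗᵢ[ℝ] ((V →L[ℝ] ℝ) →L[ℝ] ℝ) :=
    LinearIsometryEquiv.ofSurjective (NormedSpace.inclusionInDoubleDualLi ℝ) hV with he
  refine ⟨e.symm.toContinuousLinearEquiv.toContinuousLinearMap.compLp G, ?_⟩
  ext l
  obtain ⟨g, hg⟩ := exists_dual_representation hp hqt l
  have hl : l = P g := by
    ext f
    rw [hg f, hP, ContinuousLinearMap.lpPairing_eq_integral]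
    rfl
  rw [NormedSpace.dual_def, hg]
  have h1 : Λ l = ∫ t, G t (g t) ∂μ := by
    rw [hl]
    exact hG g
  rw [h1]
  refine integral_congr_ae ?_
  filter_upwards [ContinuousLinearMap.coeFn_compLp
    e.symm.toContinuousLinearEquiv.toContinuousLinearMap G] with t ht
  rw [ht]
  obtain ⟨v, hv⟩ := e.surjective (G t)
  have h2 : e v (g t) = g t v := rfl
  rw [← hv, h2]
  simp

/-- The dual of a Bochner space over a separable reflexive space is separable. -/
theorem IsReflexive.separableSpace_dual_lp [TopologicalSpace.SeparableSpace V]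
    [IsSeparable μ]
    (hV : IsReflexive V) {p : ℝ≥0∞} [Fact (1 ≤ p)] (hp1 : 1 < p) (hp : p ≠ ∞) :
    TopologicalSpace.SeparableSpace (Lp V p μ →L[ℝ] ℝ) := by
  have := hV.separableSpace_dual
  set q := ENNReal.conjExponent p with hq
  have hpq : p.HolderConjugate q := ENNReal.HolderConjugate.conjExponent hp1.le
  have hqp : q.HolderConjugate p := hpq.symm
  have : Fact (1 ≤ q) := ⟨ENNReal.HolderConjugate.one_le q p⟩
  have hqt : q ≠ ∞ := (ENNReal.HolderConjugate.ne_top_iff_ne_one q p).2 hp1.ne'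
  have : Fact (q ≠ ∞) := ⟨hqt⟩
  set P : Lp (V →L[ℝ] ℝ) q μ →L[ℝ] (Lp V p μ →L[ℝ] ℝ) :=
    (ContinuousLinearMap.id ℝ (V →L[ℝ] ℝ)).lpPairing μ q p with hP
  -- The dual is a continuous image of L^q with values in the dual of `V`, which is separable since
  -- `q` is finite.
  have hsurj : Function.Surjective P := by
    intro l
    obtain ⟨g, hg⟩ := exists_dual_representation hp hqt l
    refine ⟨g, ?_⟩
    ext f
    rw [hg f, hP, ContinuousLinearMap.lpPairing_eq_integral]
    rfl
  exact hsurj.denseRange.separableSpace P.continuous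

end LpReflexive

/-! ### Weak sequential compactness of the state space -/

section StateSpaceCompact

variable {V Z : Type*} [NormedAddCommGroup V] [NormedSpace ℝ V]
    [NormedAddCommGroup Z] [NormedSpace ℝ Z] {T : ℝ} {p : ℝ≥0∞} [Fact (1 ≤ p)]

/-- Functionals on a subspace extend to the whole space by Hahn–Banach. This reduces weak
convergence in the state space to that of the two components. -/
lemma weakTendsto_subtype_iff {E : Type*} [NormedAddCommGroup E] [NormedSpace ℝ E]
    {S : Submodule ℝ E} {u : ℕ → S} {v : S} :
    WeakTendsto u v ↔ WeakTendsto (fun n => (u n : E)) (v : E) := by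
  refine ⟨fun h => h.comp_clm S.subtypeL, fun h l => ?_⟩
  obtain ⟨L, hL, -⟩ := exists_extension_norm_eq S l
  simpa [hL] using h L

lemma WeakTendsto.prodMk {E F : Type*} [NormedAddCommGroup E] [NormedSpace ℝ E]
    [NormedAddCommGroup F] [NormedSpace ℝ F] {u : ℕ → E} {v : ℕ → F} {a : E} {b : F}
    (hu : WeakTendsto u a) (hv : WeakTendsto v b) :
    WeakTendsto (fun n => (u n, v n)) (a, b) := by
  intro l
  have h := (hu (l.comp (ContinuousLinearMap.inl ℝ E F))).add
    (hv (l.comp (ContinuousLinearMap.inr ℝ E F)))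
  have e : ∀ x y, l (x, y) = l.comp (ContinuousLinearMap.inl ℝ E F) x +
      l.comp (ContinuousLinearMap.inr ℝ E F) y := by
    intro x y
    simp [← map_add]
  simpa only [e] using h

/-- Integration of functions in `L^p(0,T;Z)` against a test function. -/
lemma exists_clm_integral_smul {φ : ℝ → ℝ} (hφ : Continuous φ) (hs : HasCompactSupport φ)
    (ξ : Z →L[ℝ] ℝ) :
    ∃ l : Lp Z p (timeMeasure T) →L[ℝ] ℝ, ∀ f, l f = ∫ t, φ t * ξ (f t) ∂(timeMeasure T) := by
  obtain ⟨C, hC⟩ := hφ.bounded_above_of_compact_support hs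
  set q := ENNReal.conjExponent p with hq
  have hpq : p.HolderConjugate q := ENNReal.HolderConjugate.conjExponent Fact.out
  have hqp : q.HolderConjugate p := hpq.symm
  have : Fact (1 ≤ q) := ⟨ENNReal.HolderConjugate.one_le q p⟩
  have hm : MemLp (fun t => φ t • ξ) q (timeMeasure T) :=
    MemLp.of_bound (hφ.smul continuous_const).aestronglyMeasurable (C * ‖ξ‖)
      (Eventually.of_forall fun t => by
        rw [norm_smul]
        exact mul_le_mul_of_nonneg_right (hC t) (norm_nonneg _))
  refine ⟨(ContinuousLinearMap.id ℝ (Z →L[ℝ] ℝ)).lpPairing (timeMeasure T) q p hm.toLp,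
    fun f => ?_⟩
  rw [ContinuousLinearMap.lpPairing_eq_integral]
  refine integral_congr_ae ?_
  filter_upwards [hm.coeFn_toLp] with t ht
  simp [ht]

/-- The state space is weakly sequentially closed. -/
lemma mem_stateSpace_of_weakTendsto [CompleteSpace Z] {i : V →L[ℝ] Z}
    {u : ℕ → StateSpace T p i} {a : Lp V p (timeMeasure T)} {b : Lp Z p (timeMeasure T)}
    (ha : WeakTendsto (fun n => (u n).1.1) a) (hb : WeakTendsto (fun n => (u n).1.2) b) :
    (a, b) ∈ StateSpace T p i := by
  intro φ hφ
  have hd : Continuous (deriv φ) := hφ.1.continuous_deriv (by simp)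
  have hds : HasCompactSupport (deriv φ) := hφ.2.1.deriv
  have hint : ∀ a : Lp V p (timeMeasure T),
      Integrable (fun t => deriv φ t • i (a t)) (timeMeasure T) := by
    intro a
    refine (i.integrable_comp (integrable_test_smul hd hds a)).congr ?_
    exact Eventually.of_forall fun t => by simp
  -- Tested with `ξ`, both sides of the weak derivative identity become continuous linear
  -- functionals on L^p, which pass to weak limits.
  refine (SeparatingDual.eq_iff_forall_dual_eq (R := ℝ)).2 fun ξ => ?_
  obtain ⟨l1, hl1⟩ := exists_clm_integral_smul (p := p) (T := T) hd hds (ξ.comp i)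
  obtain ⟨l2, hl2⟩ := exists_clm_integral_smul (p := p) (T := T) hφ.1.continuous hφ.2.1 ξ
  have e1 : ∀ a : Lp V p (timeMeasure T), ξ (∫ t, deriv φ t • i (a t) ∂(timeMeasure T)) = l1 a := by
    intro a
    rw [← ξ.integral_comp_comm (hint a), hl1]
    simp
  have e2 : ∀ b : Lp Z p (timeMeasure T), ξ (-∫ t, φ t • b t ∂(timeMeasure T)) = - l2 b := by
    intro b
    rw [map_neg, ← ξ.integral_comp_comm (integrable_test_smul hφ.1.continuous hφ.2.1 b), hl2]
    simp
  rw [e1, e2]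
  refine tendsto_nhds_unique (ha l1) ?_
  refine (hb l2).neg.congr fun n => ?_
  rw [← e1, ← e2, (u n).2 φ hφ]

/-- Bounded sequences in the state space have weakly convergent subsequences. -/
theorem StateSpace.exists_weakTendsto_subseq [CompleteSpace V] [TopologicalSpace.SeparableSpace V]
    [CompleteSpace Z] [TopologicalSpace.SeparableSpace Z] (hV : IsReflexive V)
    (hZ : IsReflexive Z) (hp1 : 1 < p) (hp : p ≠ ∞) {i : V →L[ℝ] Z}
    {u : ℕ → StateSpace T p i} {M : ℝ} (hu : ∀ n, ‖u n‖ ≤ M) :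
    ∃ (v : StateSpace T p i) (φ : ℕ → ℕ), StrictMono φ ∧ WeakTendsto (u ∘ φ) v := by
  have : IsFiniteMeasure (timeMeasure T) := by
    constructor; simp
  have := hV.separableSpace_dual_lp (μ := timeMeasure T) hp1 hp
  have := hZ.separableSpace_dual_lp (μ := timeMeasure T) hp1 hp
  obtain ⟨a, φ, hφ, ha⟩ := (hV.lp (μ := timeMeasure T) hp1 hp).exists_weakTendsto_subseq
    (u := fun n => (u n).1.1) (M := M) fun n => (norm_fst_le _).trans (hu n)
  obtain ⟨b, ψ, hψ, hb⟩ := (hZ.lp (μ := timeMeasure T) hp1 hp).exists_weakTendsto_subseq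
    (u := fun n => (u (φ n)).1.2) (M := M) fun n => (norm_snd_le _).trans (hu _)
  have ha' : WeakTendsto (fun n => (u (φ (ψ n))).1.1) a := ha.comp_strictMono hψ
  refine ⟨⟨(a, b), mem_stateSpace_of_weakTendsto (u := fun n => u (φ (ψ n))) ha' hb⟩, φ ∘ ψ,
    hφ.comp hψ, ?_⟩
  exact weakTendsto_subtype_iff.2 (ha'.prodMk hb)

end StateSpaceCompact

/-! ### Scalar weak derivatives in time -/

section DuBoisReymond

variable {T : ℝ}

/-- A test function with vanishing integral is the derivative of a test function. -/
lemma IsTest.exists_primitive {η : ℝ → ℝ} (hη : IsTest (Ioo 0 T) η) (hT : 0 < T)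
    (h0 : ∫ t, η t = 0) : ∃ φ : ℝ → ℝ, IsTest (Ioo 0 T) φ ∧ deriv φ = η := by
  obtain ⟨hsm, hcs, hsub⟩ := hη
  obtain ⟨a, b, ha, hb, hab⟩ : ∃ a b, 0 < a ∧ b < T ∧ tsupport η ⊆ Icc a b := by
    rcases (tsupport η).eq_empty_or_nonempty with he | hne
    · exact ⟨T / 2, T / 2, by linarith, by linarith, by simp [he]⟩
    · obtain ⟨a, ha, ha'⟩ := hcs.isCompact.exists_isLeast hne
      obtain ⟨b, hb, hb'⟩ := hcs.isCompact.exists_isGreatest hne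
      exact ⟨a, b, (hsub ha).1, (hsub hb).2, fun x hx => ⟨ha' hx, hb' hx⟩⟩
  have hz : ∀ x, x ∉ Icc a b → η x = 0 := fun x hx =>
    image_eq_zero_of_notMem_tsupport fun h => hx (hab h)
  have hcont : Continuous η := hsm.continuous
  have hderiv : ∀ t, HasDerivAt (fun t => ∫ s in (0 : ℝ)..t, η s) (η t) t := fun t =>
    intervalIntegral.integral_hasDerivAt_right (hcont.intervalIntegrable _ _)
      (hcont.stronglyMeasurableAtFilter _ _) hcont.continuousAt
  have hd : deriv (fun t => ∫ s in (0 : ℝ)..t, η s) = η := funext fun t => (hderiv t).deriv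
  -- Left of `a` the integrand vanishes; right of `b` the integral is already the total integral,
  -- which is zero.
  have hsupp : ∀ t, t ∉ Icc a b → ∫ s in (0 : ℝ)..t, η s = 0 := by
    intro t ht
    rcases lt_or_ge t a with hta | hta
    · refine intervalIntegral.integral_zero_ae (Eventually.of_forall fun s hs => hz s ?_)
      rintro ⟨h1, h2⟩
      rcases mem_uIoc.1 hs with h | h <;> linarith [h.1, h.2]
    · have htb : b < t := by
        by_contra h
        exact ht ⟨hta, not_lt.1 h⟩
      have ht0 : 0 ≤ t := ha.le.trans hta
      rw [intervalIntegral.integral_of_le ht0, setIntegral_eq_integral_of_forall_compl_eq_zero, h0]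
      intro x hx
      refine hz x ?_
      rintro ⟨h1, h2⟩
      exact hx ⟨by linarith, by linarith⟩
  have hts : tsupport (fun t => ∫ s in (0 : ℝ)..t, η s) ⊆ Icc a b := by
    refine closure_minimal (fun t ht => ?_) isClosed_Icc
    by_contra h
    exact ht (hsupp t h)
  refine ⟨fun t => ∫ s in (0 : ℝ)..t, η s, ⟨?_, ?_, ?_⟩, hd⟩
  · refine contDiff_infty_iff_deriv.2 ⟨fun t => (hderiv t).differentiableAt, ?_⟩
    rw [hd]
    exact hsm
  · exact isCompact_Icc.of_isClosed_subset (isClosed_tsupport _) hts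
  · exact hts.trans fun x hx => ⟨by linarith [hx.1], by linarith [hx.2]⟩

/-- The lemma of du Bois-Reymond: functions with vanishing weak derivative are constant. -/
lemma ae_eq_const_of_integral_deriv_mul_eq_zero (hT : 0 < T) {h : ℝ → ℝ}
    (hi : Integrable h (timeMeasure T))
    (h0 : ∀ φ : ℝ → ℝ, IsTest (Ioo 0 T) φ → ∫ t, deriv φ t * h t ∂(timeMeasure T) = 0) :
    ∃ c : ℝ, h =ᵐ[timeMeasure T] fun _ => c := by
  -- Outer radius `T / 4` around the midpoint keeps the support inside the interval.
  let f : ContDiffBump (T / 2) := ⟨T / 8, T / 4, by linarith, by linarith⟩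
  set ψ : ℝ → ℝ := f.normed volume with hψ
  have hψt : IsTest (Ioo 0 T) ψ := by
    refine ⟨f.contDiff_normed, f.hasCompactSupport_normed, ?_⟩
    rw [hψ, f.tsupport_normed_eq, Real.closedBall_eq_Icc]
    intro x hx
    have h1 := hx.1
    have h2 := hx.2
    simp only [f] at h1 h2
    exact ⟨by linarith, by linarith⟩
  have hψ1 : ∫ t, ψ t = 1 := f.integral_normed
  have hint : ∀ χ : ℝ → ℝ, IsTest (Ioo 0 T) χ → Integrable (fun t => χ t * h t) (timeMeasure T) := by
    intro χ hχ
    obtain ⟨C, hC⟩ := hχ.1.continuous.bounded_above_of_compact_support hχ.2.1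
    exact hi.bdd_mul hχ.1.continuous.aestronglyMeasurable (Eventually.of_forall hC)
  set c := ∫ t, ψ t * h t ∂(timeMeasure T) with hc
  have hmain : ∀ χ : ℝ → ℝ, IsTest (Ioo 0 T) χ →
      ∫ t, χ t * (h t - c) ∂(timeMeasure T) = 0 := by
    intro χ hχ
    set m := ∫ t, χ t with hm
    -- Subtracting `m * ψ` makes the integral vanish, so the difference is the derivative of a test
    -- function and is orthogonal to `h`.
    have hη : IsTest (Ioo 0 T) (fun t => χ t - m * ψ t) := by
      refine ⟨hχ.1.sub (contDiff_const.mul hψt.1), ?_, ?_⟩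
      · exact hχ.2.1.sub (hψt.2.1.mul_left)
      · refine (tsupport_sub _ _).trans (union_subset hχ.2.2 ?_)
        exact (tsupport_mul_subset_right).trans hψt.2.2
    have hη0 : ∫ t, (χ t - m * ψ t) = 0 := by
      rw [integral_sub (hχ.1.continuous.integrable_of_hasCompactSupport hχ.2.1)
        ((hψt.1.continuous.integrable_of_hasCompactSupport hψt.2.1).const_mul m),
        integral_const_mul, hψ1, mul_one, sub_self]
    obtain ⟨φ, hφ, hφd⟩ := hη.exists_primitive hT hη0
    have h1 := h0 φ hφ
    rw [hφd] at h1
    have h2 : ∫ t, (χ t - m * ψ t) * h t ∂(timeMeasure T) =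
        ∫ t, χ t * h t ∂(timeMeasure T) - m * c := by
      rw [hc, ← integral_const_mul, ← integral_sub (hint χ hχ) ((hint ψ hψt).const_mul m)]
      refine integral_congr_ae (Eventually.of_forall fun t => ?_)
      simp only
      ring
    have h3 : ∫ t, χ t ∂(timeMeasure T) = m := by
      rw [hm]
      refine setIntegral_eq_integral_of_forall_compl_eq_zero fun x hx => ?_
      exact image_eq_zero_of_notMem_tsupport fun h => hx (hχ.2.2 h)
    simp only [mul_sub]
    rw [integral_sub (hint χ hχ) ((hχ.1.continuous.integrable_of_hasCompactSupport
      hχ.2.1).restrict.mul_const c), integral_mul_const, h3]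
    linarith
  refine ⟨c, ?_⟩
  have hloc : LocallyIntegrableOn (fun t => h t - c) (Ioo 0 T) volume := by
    have : IntegrableOn (fun t => h t - c) (Ioo 0 T) volume := by
      refine Integrable.sub hi ?_
      exact integrable_const c
    exact this.locallyIntegrableOn
  have := isOpen_Ioo.ae_eq_zero_of_integral_contDiff_smul_eq_zero hloc fun g hg1 hg2 hg3 => by
    rw [← hmain g ⟨hg1, hg2, hg3⟩]
    symm
    refine setIntegral_eq_integral_of_forall_compl_eq_zero fun x hx => ?_
    rw [image_eq_zero_of_notMem_tsupport fun h => hx (hg3 h), zero_mul]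
  rw [EventuallyEq, ae_restrict_iff' measurableSet_Ioo]
  filter_upwards [this] with t ht hmem
  linarith [ht hmem]

/-- A function with an integrable weak derivative is a primitive of it. -/
lemma ae_eq_const_add_integral (hT : 0 < T) {w w' : ℝ → ℝ}
    (hw : Integrable w (timeMeasure T)) (hw' : Integrable w' (timeMeasure T))
    (h : ∀ φ : ℝ → ℝ, IsTest (Ioo 0 T) φ →
      ∫ t, deriv φ t * w t ∂(timeMeasure T) = - ∫ t, φ t * w' t ∂(timeMeasure T)) :
    ∃ c : ℝ, ∀ᵐ t ∂(timeMeasure T), w t = c + ∫ s in Ioo 0 t, w' s ∂(timeMeasure T) := by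
  have hii : IntervalIntegrable w' volume 0 T := by
    rw [intervalIntegrable_iff_integrableOn_Ioo_of_le hT.le]
    exact hw'
  set g : ℝ → ℝ := fun t => ∫ s in (0 : ℝ)..t, w' s with hg
  have hac : AbsolutelyContinuousOnInterval g 0 T :=
    hii.absolutelyContinuousOnInterval_intervalIntegral (by simp)
  have hgd : ∀ᵐ t, t ∈ uIcc 0 T → HasDerivAt g (w' t) t := by
    filter_upwards [hii.ae_hasDerivAt_integral] with t ht hmem
    exact ht hmem 0 (by simp)
  have hgc : ContinuousOn g (Icc 0 T) := by
    have := hac.continuousOn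
    rwa [uIcc_of_le hT.le] at this
  have hgi : Integrable g (timeMeasure T) :=
    (hgc.integrableOn_Icc).mono_set Ioo_subset_Icc_self
  -- Integration by parts for absolutely continuous functions: the primitive `g` has the weak
  -- derivative `w'`, so `w - g` has weak derivative zero and is constant.
  have hparts : ∀ φ : ℝ → ℝ, IsTest (Ioo 0 T) φ →
      ∫ t, deriv φ t * g t ∂(timeMeasure T) = - ∫ t, φ t * w' t ∂(timeMeasure T) := by
    intro φ hφ
    have hφac : AbsolutelyContinuousOnInterval φ 0 T :=
      (hφ.1.of_le (by simp)).contDiffOn.absolutelyContinuousOnInterval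
    have h1 := hφac.integral_deriv_mul_eq_sub hac
    have hφ0 : φ 0 = 0 := image_eq_zero_of_notMem_tsupport fun h => (hφ.2.2 h).1.false
    have hφT : φ T = 0 := image_eq_zero_of_notMem_tsupport fun h => (hφ.2.2 h).2.false
    rw [hφ0, hφT, zero_mul, zero_mul, sub_zero, intervalIntegral.integral_of_le hT.le,
      integral_Ioc_eq_integral_Ioo] at h1
    obtain ⟨C, hC⟩ := hφ.1.continuous.bounded_above_of_compact_support hφ.2.1
    have hd : Continuous (deriv φ) := hφ.1.continuous_deriv (by simp)
    obtain ⟨C', hC'⟩ := hd.bounded_above_of_compact_support hφ.2.1.deriv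
    have i1 : Integrable (fun t => deriv φ t * g t) (timeMeasure T) :=
      hgi.bdd_mul hd.aestronglyMeasurable (Eventually.of_forall hC')
    have i2 : Integrable (fun t => φ t * w' t) (timeMeasure T) :=
      hw'.bdd_mul hφ.1.continuous.aestronglyMeasurable (Eventually.of_forall hC)
    have h2 : ∫ t in Ioo 0 T, (deriv φ t * g t + φ t * deriv g t) =
        ∫ t in Ioo 0 T, (deriv φ t * g t + φ t * w' t) := by
      refine integral_congr_ae ?_
      rw [EventuallyEq, ae_restrict_iff' measurableSet_Ioo]
      filter_upwards [hgd] with t ht hmem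
      rw [(ht (by rw [uIcc_of_le hT.le]; exact Ioo_subset_Icc_self hmem)).deriv]
    rw [h2, integral_add i1 i2] at h1
    linarith
  obtain ⟨c, hc⟩ := ae_eq_const_of_integral_deriv_mul_eq_zero hT (hw.sub hgi) fun φ hφ => by
    obtain ⟨C', hC'⟩ := (hφ.1.continuous_deriv (by simp)).bounded_above_of_compact_support
      hφ.2.1.deriv
    have hd : Continuous (deriv φ) := hφ.1.continuous_deriv (by simp)
    simp only [Pi.sub_apply, mul_sub]
    rw [integral_sub (hw.bdd_mul hd.aestronglyMeasurable (Eventually.of_forall hC'))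
      (hgi.bdd_mul hd.aestronglyMeasurable (Eventually.of_forall hC')), h φ hφ, hparts φ hφ,
      sub_self]
  refine ⟨c, ?_⟩
  filter_upwards [hc, ae_restrict_mem measurableSet_Ioo] with t ht hmem
  have e : ∫ s in Ioo 0 t, w' s ∂(timeMeasure T) = g t := by
    simp only [hg]
    rw [intervalIntegral.integral_of_le hmem.1.le, integral_Ioc_eq_integral_Ioo,
      Measure.restrict_restrict measurableSet_Ioo,
      inter_eq_left.2 (Ioo_subset_Ioo_right hmem.2.le)]
  rw [e]
  simp only [Pi.sub_apply] at ht
  linarith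

/-- Weak convergence of scalar functions and of their weak derivatives implies strong
convergence in `L^1`. -/
lemma tendsto_integral_abs_of_weak (hT : 0 < T) {w w' : ℕ → ℝ → ℝ}
    (hw : ∀ n, Integrable (w n) (timeMeasure T)) (hw' : ∀ n, Integrable (w' n) (timeMeasure T))
    (h : ∀ n, ∀ φ : ℝ → ℝ, IsTest (Ioo 0 T) φ →
      ∫ t, deriv φ t * w n t ∂(timeMeasure T) = - ∫ t, φ t * w' n t ∂(timeMeasure T))
    {M : ℝ} (hM : ∀ n, ∫ t, |w' n t| ∂(timeMeasure T) ≤ M)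
    (h0 : Tendsto (fun n => ∫ t, w n t ∂(timeMeasure T)) atTop (𝓝 0))
    (h1 : ∀ t, Tendsto (fun n => ∫ s in Ioo 0 t, w' n s ∂(timeMeasure T)) atTop (𝓝 0)) :
    Tendsto (fun n => ∫ t, |w n t| ∂(timeMeasure T)) atTop (𝓝 0) := by
  -- In the decomposition `w n = c n + g n`, the primitives `g n` tend to zero pointwise by `h1` and
  -- are bounded by `M`, hence they tend to zero in L^1. The constants `c n` follow from the total
  -- integrals in `h0`.
  choose c hc using fun n => ae_eq_const_add_integral hT (hw n) (hw' n) (h n)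
  set g : ℕ → ℝ → ℝ := fun n t => ∫ s in Ioo 0 t, w' n s ∂(timeMeasure T) with hg
  have hgi : ∀ n, Integrable (g n) (timeMeasure T) := by
    intro n
    refine ((hw n).sub (integrable_const (c n))).congr ?_
    filter_upwards [hc n] with t ht
    simp only [Pi.sub_apply, ht]
    ring
  have hgM : ∀ n t, |g n t| ≤ M := by
    intro n t
    refine (abs_integral_le_integral_abs).trans (le_trans ?_ (hM n))
    exact setIntegral_le_integral (hw' n).abs (Eventually.of_forall fun _ => abs_nonneg _)
  have hgabs : Tendsto (fun n => ∫ t, |g n t| ∂(timeMeasure T)) atTop (𝓝 0) := by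
    have := tendsto_integral_of_dominated_convergence (μ := timeMeasure T)
      (F := fun n t => |g n t|) (f := fun _ => (0 : ℝ)) (fun _ => M)
      (fun n => (hgi n).abs.aestronglyMeasurable) (integrable_const M)
      (fun n => Eventually.of_forall fun t => by simpa using hgM n t)
      (Eventually.of_forall fun t => by
        have := (h1 t).abs
        rwa [abs_zero] at this)
    simpa using this
  have hgint : Tendsto (fun n => ∫ t, g n t ∂(timeMeasure T)) atTop (𝓝 0) :=
    squeeze_zero_norm (fun n => abs_integral_le_integral_abs) hgabs
  have hcT : ∀ n, c n * T = ∫ t, w n t ∂(timeMeasure T) - ∫ t, g n t ∂(timeMeasure T) := by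
    intro n
    rw [integral_congr_ae (hc n), integral_add (integrable_const _) (hgi n)]
    simp [hT.le, mul_comm, measureReal_def]
  have hc0 : Tendsto (fun n => |c n * T|) atTop (𝓝 0) := by
    simp only [hcT]
    simpa using (h0.sub hgint).abs
  refine squeeze_zero (fun n => integral_nonneg fun _ => abs_nonneg _) (fun n => ?_)
    (by simpa only [add_zero] using hc0.add hgabs)
  calc ∫ t, |w n t| ∂(timeMeasure T) ≤ ∫ t, (|c n| + |g n t|) ∂(timeMeasure T) := by
        refine integral_mono_ae (hw n).abs ((integrable_const _).add (hgi n).abs) ?_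
        filter_upwards [hc n] with t ht
        rw [ht]
        exact abs_add_le _ _
    _ = |c n * T| + ∫ t, |g n t| ∂(timeMeasure T) := by
        rw [integral_add (integrable_const _) (hgi n).abs]
        simp [hT.le, mul_comm, measureReal_def, abs_mul, abs_of_pos hT]

end DuBoisReymond

/-! ### Compact operators and Ehrling's inequality -/

section Ehrling

variable {V Z S : Type*} [NormedAddCommGroup V] [NormedSpace ℝ V]
    [NormedAddCommGroup Z] [NormedSpace ℝ Z] [NormedAddCommGroup S] [NormedSpace ℝ S]

/-- Compact operators map weakly null sequences to sequences with a strongly null subsequence. -/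
lemma exists_subseq_tendsto_zero_of_isCompactOperator {A : V →L[ℝ] S} (hA : IsCompactOperator A)
    {v : ℕ → V} {M : ℝ} (hM : ∀ n, ‖v n‖ ≤ M) (hv : WeakTendsto v 0) :
    ∃ φ : ℕ → ℕ, StrictMono φ ∧ Tendsto (fun n => A (v (φ n))) atTop (𝓝 0) := by
  obtain ⟨K, hK, hsub⟩ := hA.image_closedBall_subset_compact M
  obtain ⟨s, -, φ, hφ, hlim⟩ := hK.tendsto_subseq (x := fun n => A (v n)) fun n =>
    hsub ⟨v n, by simpa using hM n, rfl⟩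
  have hs : s = 0 := by
    refine (SeparatingDual.eq_iff_forall_dual_eq (R := ℝ)).2 fun ξ => ?_
    have h1 := (ξ.continuous.tendsto s).comp hlim
    have h2 := (hv.comp_clm A).comp_strictMono hφ ξ
    rw [map_zero] at h2
    exact tendsto_nhds_unique h1 h2
  exact ⟨φ, hφ, hs ▸ hlim⟩

/-- There is a sequence of functionals of norm one that separates the points of a separable
space. -/
lemma exists_separating_functionals [TopologicalSpace.SeparableSpace Z] :
    ∃ ξ : ℕ → Z →L[ℝ] ℝ, ∀ z, (∀ k, ξ k z = 0) → z = 0 := by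
  have hex : ∀ z : Z, ∃ g : Z →L[ℝ] ℝ, ‖g‖ ≤ 1 ∧ g z = ‖z‖ := fun z => exists_dual_vector'' ℝ z
  choose g hg1 hg2 using hex
  refine ⟨fun k => g (TopologicalSpace.denseSeq Z k), fun z hz => ?_⟩
  by_contra hne
  obtain ⟨k, hk⟩ := (TopologicalSpace.denseRange_denseSeq Z).exists_dist_lt z
    (half_pos (norm_pos_iff.2 hne))
  set y := TopologicalSpace.denseSeq Z k with hy
  -- The norming functional of `y` vanishes at `z`, so `y` cannot be closer to `z` than ‖y‖; density
  -- puts `y` within ‖z‖ / 2 of `z`.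
  have h1 : ‖y‖ ≤ ‖y - z‖ := by
    have h2 : g y (y - z) = ‖y‖ := by
      rw [map_sub, hz k, sub_zero, hg2]
    calc ‖y‖ = g y (y - z) := h2.symm
      _ ≤ ‖g y (y - z)‖ := le_abs_self _
      _ ≤ 1 * ‖y - z‖ := (g y).le_of_opNorm_le (hg1 y) _
      _ = _ := one_mul _
  rw [dist_eq_norm, norm_sub_rev] at hk
  have h3 : ‖z‖ ≤ ‖y‖ + ‖y - z‖ := by
    rw [norm_sub_rev]
    simpa using norm_add_le y (z - y)
  linarith

/-- Ehrling's lemma with finitely many functionals in place of the weak norm. -/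
lemma ehrling [TopologicalSpace.SeparableSpace V] (hV : IsReflexive V) {i : V →L[ℝ] Z}
    (hi : Function.Injective i) {A : V →L[ℝ] S} (hA : IsCompactOperator A)
    {ξ : ℕ → Z →L[ℝ] ℝ} (hξ : ∀ z, (∀ k, ξ k z = 0) → z = 0) {η : ℝ} (hη : 0 < η) :
    ∃ n : ℕ, ∀ v, ‖A v‖ ≤ η * ‖v‖ + n * ∑ k ∈ Finset.range n, |ξ k (i v)| := by
  have := hV.separableSpace_dual
  -- Normalized counterexamples have `‖A (x n)‖ > η + n * ∑ |ξ k (i (x n))|`. Boundedness of `A`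
  -- forces each `ξ k (i (x n))` to zero, so the weak limit is zero by injectivity, and compactness
  -- sends `A (x n)` to zero along a subsequence, against the lower bound `η`.
  by_contra! hcon
  choose v hv using hcon
  have hv0 : ∀ n, 0 < ‖v n‖ := by
    intro n
    refine norm_pos_iff.2 fun h => ?_
    have := hv n
    simp [h] at this
  set x : ℕ → V := fun n => ‖v n‖⁻¹ • v n with hx
  have hx1 : ∀ n, ‖x n‖ = 1 := fun n => by
    rw [hx, norm_smul, norm_inv, norm_norm, inv_mul_cancel₀ (hv0 n).ne']
  have hxA : ∀ n, η + n * ∑ k ∈ Finset.range n, |ξ k (i (x n))| < ‖A (x n)‖ := by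
    intro n
    have h1 : ∀ k, |ξ k (i (x n))| = ‖v n‖⁻¹ * |ξ k (i (v n))| := fun k => by
      simp only [hx, map_smul, smul_eq_mul, abs_mul, abs_inv, abs_norm]
    have h2 : ‖A (x n)‖ = ‖v n‖⁻¹ * ‖A (v n)‖ := by
      simp only [hx, map_smul, norm_smul, norm_inv, norm_norm]
    simp only [h1, h2, ← Finset.mul_sum]
    have := mul_lt_mul_of_pos_left (hv n) (inv_pos.2 (hv0 n))
    refine lt_of_eq_of_lt ?_ this
    have := (hv0 n).ne'
    field_simp
  obtain ⟨a, φ, hφ, ha⟩ := hV.exists_weakTendsto_subseq (M := 1) fun n => (hx1 n).le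
  have ha0 : a = 0 := by
    refine hi ?_
    rw [map_zero]
    refine hξ _ fun k => ?_
    have hlim : Tendsto (fun n => ξ k (i (x (φ n)))) atTop (𝓝 (ξ k (i a))) := ha ((ξ k).comp i)
    refine tendsto_nhds_unique hlim ?_
    have hbound : ∀ᶠ n in atTop, ‖ξ k (i (x (φ n)))‖ ≤ ‖A‖ * (1 / (φ n : ℝ)) := by
      filter_upwards [eventually_gt_atTop k] with n hn
      have hkn : k < φ n := hn.trans_le (hφ.id_le n)
      have h1 := hxA (φ n)
      have h2 : ‖A (x (φ n))‖ ≤ ‖A‖ := by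
        simpa [hx1] using A.le_opNorm (x (φ n))
      have h3 : |ξ k (i (x (φ n)))| ≤ ∑ k ∈ Finset.range (φ n), |ξ k (i (x (φ n)))| :=
        Finset.single_le_sum (f := fun k => |ξ k (i (x (φ n)))|) (fun _ _ => abs_nonneg _)
          (Finset.mem_range.2 hkn)
      have hpos : (0 : ℝ) < φ n := by exact_mod_cast (Nat.zero_le k).trans_lt hkn
      rw [mul_one_div, le_div_iff₀ hpos, Real.norm_eq_abs]
      nlinarith
    refine squeeze_zero_norm' hbound ?_
    have := (tendsto_one_div_atTop_nhds_zero_nat (𝕜 := ℝ)).comp hφ.tendsto_atTop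
    simpa using this.const_mul ‖A‖
  rw [ha0] at ha
  obtain ⟨ψ, -, hψ⟩ := exists_subseq_tendsto_zero_of_isCompactOperator hA (M := 1) (fun n => (hx1 (φ n)).le) ha
  have hle : η ≤ 0 := by
    refine ge_of_tendsto' (by simpa using hψ.norm) fun n => ?_
    refine le_trans ?_ (hxA (φ (ψ n))).le
    have : 0 ≤ ((φ (ψ n) : ℕ) : ℝ) * ∑ k ∈ Finset.range (φ (ψ n)), |ξ k (i (x (φ (ψ n))))| :=
      mul_nonneg (Nat.cast_nonneg _) (Finset.sum_nonneg fun _ _ => abs_nonneg _)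
    linarith
  linarith

end Ehrling

/-! ### The Aubin–Lions lemma -/

section AubinLions

variable {V Z S : Type*} [NormedAddCommGroup V] [NormedSpace ℝ V]
    [NormedAddCommGroup Z] [NormedSpace ℝ Z] [NormedAddCommGroup S] [NormedSpace ℝ S]
    {T : ℝ} {p : ℝ≥0∞} [Fact (1 ≤ p)]

/-- Integration of a functional of an `L^p` function over a measurable set of times. -/
lemma exists_clm_setIntegral {s : Set ℝ} (hs : MeasurableSet s) (ξ : Z →L[ℝ] ℝ) :
    ∃ l : Lp Z p (timeMeasure T) →L[ℝ] ℝ, ∀ f, l f = ∫ t in s, ξ (f t) ∂(timeMeasure T) := by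
  set q := ENNReal.conjExponent p with hq
  have hpq : p.HolderConjugate q := ENNReal.HolderConjugate.conjExponent Fact.out
  have hqp : q.HolderConjugate p := hpq.symm
  have : Fact (1 ≤ q) := ⟨ENNReal.HolderConjugate.one_le q p⟩
  have hm : MemLp (s.indicator fun _ => ξ) q (timeMeasure T) := (memLp_const ξ).indicator hs
  refine ⟨(ContinuousLinearMap.id ℝ (Z →L[ℝ] ℝ)).lpPairing (timeMeasure T) q p hm.toLp,
    fun f => ?_⟩
  rw [ContinuousLinearMap.lpPairing_eq_integral, ← integral_indicator hs]
  refine integral_congr_ae ?_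
  filter_upwards [hm.coeFn_toLp] with t ht
  by_cases hts : t ∈ s <;> simp [ht, hts]

lemma integrable_lp_timeMeasure {Z : Type*} [NormedAddCommGroup Z] {T : ℝ} {p : ℝ≥0∞}
    [Fact (1 ≤ p)] (f : Lp Z p (timeMeasure T)) : Integrable f (timeMeasure T) :=
  (Lp.memLp f).integrable Fact.out

lemma rpow_measure_univ_ne_top {X : Type*} [MeasurableSpace X] {μ : Measure X} [IsFiniteMeasure μ]
    {p : ℝ≥0∞} (hp1 : 1 ≤ p) : μ univ ^ (1 / (1 : ℝ≥0∞).toReal - 1 / p.toReal) ≠ ∞ := by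
  refine ENNReal.rpow_ne_top_of_nonneg (sub_nonneg.2 ?_) (measure_ne_top _ _)
  rw [ENNReal.toReal_one, div_one]
  rcases eq_or_ne p ∞ with rfl | hp
  · simp
  · have : 1 ≤ p.toReal := by
      rw [← ENNReal.toReal_one]
      exact ENNReal.toReal_mono hp hp1
    exact div_le_one_of_le₀ this (zero_le_one.trans this)

/-- On a bounded time interval the `L^1` norm is dominated by the `L^p` norm. -/
lemma exists_integral_norm_le (Z : Type*) [NormedAddCommGroup Z] (T : ℝ) (p : ℝ≥0∞)
    [Fact (1 ≤ p)] :
    ∃ C : ℝ, 0 ≤ C ∧ ∀ f : Lp Z p (timeMeasure T), ∫ t, ‖f t‖ ∂(timeMeasure T) ≤ C * ‖f‖ := by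
  set c : ℝ≥0∞ := timeMeasure T univ ^ (1 / (1 : ℝ≥0∞).toReal - 1 / p.toReal) with hc
  have hcfin : c ≠ ∞ := rpow_measure_univ_ne_top Fact.out
  refine ⟨c.toReal, ENNReal.toReal_nonneg, fun f => ?_⟩
  have h1 : eLpNorm f 1 (timeMeasure T) ≤ eLpNorm f p (timeMeasure T) * c :=
    eLpNorm_le_eLpNorm_mul_rpow_measure_univ Fact.out (Lp.aestronglyMeasurable f)
  rw [integral_norm_eq_lintegral_enorm (Lp.aestronglyMeasurable f), ← eLpNorm_one_eq_lintegral_enorm,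
    mul_comm, Lp.norm_def, ← ENNReal.toReal_mul]
  exact ENNReal.toReal_mono (ENNReal.mul_ne_top (Lp.eLpNorm_ne_top f) hcfin) h1

/-- The lemma of Aubin and Lions: weakly null bounded sequences in the state space are strongly
null in `L^1(0,T;S)` if `V` is compactly mapped into `S`. -/
lemma tendsto_integral_norm_of_weakTendsto [TopologicalSpace.SeparableSpace V]
    [CompleteSpace Z] [TopologicalSpace.SeparableSpace Z] (hT : 0 < T) (hV : IsReflexive V)
    {i : V →L[ℝ] Z} (hi : Function.Injective i) {A : V →L[ℝ] S} (hA : IsCompactOperator A)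
    {w : ℕ → StateSpace T p i} {M : ℝ} (hM : ∀ n, ‖w n‖ ≤ M) (hw : WeakTendsto w 0) :
    Tendsto (fun n => ∫ t, ‖A ((w n).1.1 t)‖ ∂(timeMeasure T)) atTop (𝓝 0) := by
  have hw1 : WeakTendsto (fun n => (w n).1.1) 0 :=
    hw.comp_clm ((ContinuousLinearMap.fst ℝ _ _).comp (StateSpace T p i).subtypeL)
  have hw2 : WeakTendsto (fun n => (w n).1.2) 0 :=
    hw.comp_clm ((ContinuousLinearMap.snd ℝ _ _).comp (StateSpace T p i).subtypeL)
  obtain ⟨ξ, hξ⟩ := exists_separating_functionals (Z := Z)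
  obtain ⟨C, hC0, hC⟩ := exists_integral_norm_le V T p
  obtain ⟨C', hC'0, hC'⟩ := exists_integral_norm_le Z T p
  -- The scalar functions `ξ k ∘ i ∘ w n` have the weak derivatives `ξ k ∘ (w n)'`, so the
  -- one-dimensional result gives their strong convergence in L^1; Ehrling's inequality with
  -- finitely many `k` then controls `A`.
  have hscalar : ∀ k, Tendsto (fun n => ∫ t, |ξ k (i ((w n).1.1 t))| ∂(timeMeasure T))
      atTop (𝓝 0) := by
    intro k
    have hint1 : ∀ n, Integrable (fun t => i ((w n).1.1 t)) (timeMeasure T) := fun n =>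
      i.integrable_comp (integrable_lp_timeMeasure _)
    have hint2 : ∀ n, Integrable (fun t => ξ k ((w n).1.2 t)) (timeMeasure T) := fun n =>
      (ξ k).integrable_comp (integrable_lp_timeMeasure _)
    refine tendsto_integral_abs_of_weak hT (w' := fun n t => ξ k ((w n).1.2 t))
      (M := ‖ξ k‖ * (C' * M)) (fun n => (ξ k).integrable_comp (hint1 n)) hint2 ?_ ?_ ?_ ?_
    · intro n φ hφ
      have h1 := congrArg (ξ k) ((w n).2 φ hφ)
      have hd : Continuous (deriv φ) := hφ.1.continuous_deriv (by simp)
      have j1 : Integrable (fun t => deriv φ t • i ((w n).1.1 t)) (timeMeasure T) := by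
        refine (i.integrable_comp (integrable_test_smul hd hφ.2.1.deriv (w n).1.1)).congr ?_
        exact Eventually.of_forall fun t => by simp
      rw [map_neg, ← (ξ k).integral_comp_comm j1, ← (ξ k).integral_comp_comm
        (integrable_test_smul hφ.1.continuous hφ.2.1 _)] at h1
      simpa using h1
    · intro n
      calc ∫ t, |ξ k ((w n).1.2 t)| ∂(timeMeasure T)
          ≤ ∫ t, ‖ξ k‖ * ‖(w n).1.2 t‖ ∂(timeMeasure T) :=
            integral_mono (hint2 n).abs ((integrable_lp_timeMeasure _).norm.const_mul _)
              fun t => (ξ k).le_opNorm _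
        _ ≤ ‖ξ k‖ * (C' * M) := by
            rw [integral_const_mul]
            gcongr
            refine (hC' _).trans ?_
            gcongr
            exact (norm_snd_le _).trans (hM n)
    · obtain ⟨l, hl⟩ := exists_clm_setIntegral (p := p) (T := T) MeasurableSet.univ
        ((ξ k).comp i)
      have := hw1 l
      rw [map_zero] at this
      simpa [hl] using this
    · intro t
      obtain ⟨l, hl⟩ := exists_clm_setIntegral (p := p) (T := T) (measurableSet_Ioo (a := 0) (b := t))
        (ξ k)
      have := hw2 l
      rw [map_zero] at this
      simpa only [hl] using this
  rw [Metric.tendsto_atTop]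
  intro ε hε
  -- `C * |M|` bounds the L^1 norms of the states, so the first Ehrling term costs at most `ε / 2`;
  -- the added 1 keeps the denominator positive.
  have hη : 0 < ε / (2 * (C * |M| + 1)) := by positivity
  obtain ⟨n₀, hn₀⟩ := ehrling hV hi hA hξ hη
  have hsum : Tendsto (fun n => (n₀ : ℝ) * ∑ k ∈ Finset.range n₀,
      ∫ t, |ξ k (i ((w n).1.1 t))| ∂(timeMeasure T)) atTop (𝓝 0) := by
    have := (tendsto_finsetSum (Finset.range n₀) fun k _ => hscalar k).const_mul (n₀ : ℝ)
    simpa using this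
  obtain ⟨m, hm⟩ := Metric.tendsto_atTop.1 hsum (ε / 2) (half_pos hε)
  refine ⟨m, fun n hn => ?_⟩
  have h1 := hm n hn
  rw [Real.dist_0_eq_abs] at h1 ⊢
  rw [abs_of_nonneg (integral_nonneg fun _ => norm_nonneg _)]
  have hi1 : Integrable (fun t => ‖(w n).1.1 t‖) (timeMeasure T) :=
    (integrable_lp_timeMeasure _).norm
  have hi2 : ∀ k, Integrable (fun t => |ξ k (i ((w n).1.1 t))|) (timeMeasure T) := fun k =>
    ((ξ k).integrable_comp (i.integrable_comp (integrable_lp_timeMeasure (w n).1.1))).abs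
  calc ∫ t, ‖A ((w n).1.1 t)‖ ∂(timeMeasure T)
      ≤ ∫ t, (ε / (2 * (C * |M| + 1)) * ‖(w n).1.1 t‖ + n₀ * ∑ k ∈ Finset.range n₀,
          |ξ k (i ((w n).1.1 t))|) ∂(timeMeasure T) :=
        integral_mono (A.integrable_comp (integrable_lp_timeMeasure (w n).1.1)).norm
          ((hi1.const_mul _).add ((integrable_finsetSum _ fun k _ => hi2 k).const_mul _))
          fun t => hn₀ _
    _ = ε / (2 * (C * |M| + 1)) * ∫ t, ‖(w n).1.1 t‖ ∂(timeMeasure T) +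
          n₀ * ∑ k ∈ Finset.range n₀, ∫ t, |ξ k (i ((w n).1.1 t))| ∂(timeMeasure T) := by
        rw [integral_add (hi1.const_mul _)
          ((integrable_finsetSum _ fun k _ => hi2 k).const_mul _), integral_const_mul,
          integral_const_mul, integral_finsetSum _ fun k _ => hi2 k]
    _ < ε / 2 + ε / 2 := by
        refine add_lt_add_of_le_of_lt ?_ ((le_abs_self _).trans_lt h1)
        have h2 : ∫ t, ‖(w n).1.1 t‖ ∂(timeMeasure T) ≤ C * |M| + 1 := by
          refine (hC _).trans ?_
          have : ‖(w n).1.1‖ ≤ |M| := (norm_fst_le _).trans ((hM n).trans (le_abs_self M))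
          nlinarith
        calc ε / (2 * (C * |M| + 1)) * ∫ t, ‖(w n).1.1 t‖ ∂(timeMeasure T)
            ≤ ε / (2 * (C * |M| + 1)) * (C * |M| + 1) := by gcongr
          _ = ε / 2 := by field_simp
    _ = ε := add_halves ε

end AubinLions

/-! ### Continuity of networks in parameters and inputs -/

section NetworkContinuity

variable {ι : Type} [Fintype ι] [DecidableEq ι]

lemma continuous_polyEval {d : ℕ} {X : Type*} [TopologicalSpace X] {a : X → MultiIdx ι d → ℝ}
    {x : X → ι → ℝ} (ha : Continuous a) (hx : Continuous x) :
    Continuous fun s => polyEval (a s) (x s) := by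
  unfold polyEval
  fun_prop

/-- The uniform lower bound on admissible denominators excludes division by zero, so continuity is
joint in coefficients and arguments. -/
lemma continuous_ratEval {d : ℕ} {ε : ℝ} (hε : 0 < ε) {X : Type*} [TopologicalSpace X]
    {c : X → RatParam ι d} {x : X → ι → ℝ} (hc : Continuous c) (hx : Continuous x)
    (hden : ∀ s, (c s).2 ∈ denominators ι d ε) :
    Continuous fun s => ratEval (c s) (x s) := by
  unfold ratEval
  refine (continuous_polyEval hc.fst hx).div (continuous_polyEval hc.snd hx) fun s => ?_
  exact (hε.trans_le ((hden s).1 (x s))).ne'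

lemma isClosed_denominators (ι : Type) [Fintype ι] [DecidableEq ι] (d : ℕ) (ε : ℝ) :
    IsClosed (denominators ι d ε) := by
  have : denominators ι d ε = (⋂ x : ι → ℝ, {b | ε ≤ polyEval b x}) ∩ {b | ∑ k, b k ^ 2 = 1} := by
    ext b
    simp [denominators]
  rw [this]
  refine (isClosed_iInter fun x => isClosed_le continuous_const
    (continuous_polyEval continuous_id continuous_const)).inter (isClosed_eq ?_ continuous_const)
  fun_prop

lemma Architecture.isClosed_paramSet (A : Architecture ι) (ε : ℝ) : IsClosed (A.paramSet ε) := by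
  have : A.paramSet ε = (⋂ i : Fin A.depth, ⋂ j : Fin (A.nr i), (fun θ : A.Params => (θ.1 i j).2) ⁻¹'
      denominators (LayerIn ι A.ns i) (A.deg i) ε) ∩ (fun θ : A.Params => θ.2.2) ⁻¹'
      denominators (LayerIn ι A.ns A.depth ⊕ ι) (A.deg A.depth) ε := by
    ext θ
    simp [Architecture.paramSet]
  rw [this]
  refine IsClosed.inter (isClosed_iInter fun i => isClosed_iInter fun j =>
    (isClosed_denominators _ _ _).preimage ?_) ((isClosed_denominators _ _ _).preimage ?_)
  · exact (((continuous_apply j).comp ((continuous_apply i).comp continuous_fst))).snd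
  · exact continuous_snd.snd

/-- Closedness in a finite-dimensional space; it makes limits of bounded parameter sequences
admissible again. -/
lemma Architecture.properSpace_paramSet (A : Architecture ι) (ε : ℝ) :
    ProperSpace (A.paramSet ε) :=
  ⟨fun x r => (A.isClosed_paramSet ε).isClosedEmbedding_subtypeVal.isCompact_preimage
    (isCompact_closedBall x.1 r)⟩

lemma Architecture.continuous_hidden (A : Architecture ι) {ε : ℝ} (hε : 0 < ε) (i : ℕ)
    (hi : i ≤ A.depth) :
    Continuous fun z : A.paramSet ε × (ι → ℝ) => A.hidden z.1.1 z.2 i hi := by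
  induction i with
  | zero => exact continuous_snd
  | succ i ih =>
    have ih := ih (Nat.le_of_succ_le hi)
    refine (A.continuous_act ⟨i, hi⟩).comp (continuous_pi fun j => ?_)
    refine continuous_ratEval hε ?_ ih fun s => s.1.2.1 ⟨i, hi⟩ j
    exact (continuous_apply j).comp ((continuous_apply (⟨i, hi⟩ : Fin A.depth)).comp
      (continuous_fst.comp (continuous_subtype_val.comp continuous_fst)))

/-- Networks depend continuously on their parameters and inputs. -/
lemma Architecture.continuous_eval (A : Architecture ι) {ε : ℝ} (hε : 0 < ε) :
    Continuous fun z : A.paramSet ε × (ι → ℝ) => A.eval z.1.1 z.2 := by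
  refine continuous_ratEval hε (continuous_snd.comp (continuous_subtype_val.comp continuous_fst))
    (continuous_pi fun j => ?_) fun s => s.1.2.2
  cases j with
  | inl j => exact (continuous_apply j).comp (A.continuous_hidden hε A.depth le_rfl)
  | inr j => exact (continuous_apply j).comp continuous_snd

/-- Convergence of parameters implies locally uniform convergence of the networks. -/
lemma Architecture.tendsto_eLpNorm_eval (A : Architecture ι) {ε : ℝ} (hε : 0 < ε)
    {θ : ℕ → A.paramSet ε} {θ₀ : A.paramSet ε} (h : Tendsto θ atTop (𝓝 θ₀)) {U : Set (ι → ℝ)}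
    (hU : Bornology.IsBounded U) :
    Tendsto (fun m => eLpNorm (fun z => A.eval (θ m).1 z - A.eval θ₀.1 z) ∞ (volume.restrict U))
      atTop (𝓝 0) := by
  obtain ⟨R, hR⟩ := hU.subset_closedBall (0 : ι → ℝ)
  -- Currying turns joint continuity into continuity of θ ↦ network for the compact-open topology,
  -- that is, for uniform convergence on compact sets.
  set F : C(A.paramSet ε × (ι → ℝ), ℝ) := ⟨_, A.continuous_eval hε⟩ with hF
  have h1 : Tendsto (fun m => F.curry (θ m)) atTop (𝓝 (F.curry θ₀)) :=
    (F.curry.continuous.tendsto θ₀).comp h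
  have h2 := ContinuousMap.tendsto_iff_forall_isCompact_tendstoUniformlyOn.1 h1 _
    (isCompact_closedBall (0 : ι → ℝ) R)
  rw [Metric.tendstoUniformlyOn_iff] at h2
  rw [ENNReal.tendsto_nhds_zero]
  intro η hη
  rcases eq_or_ne η ∞ with rfl | hηt
  · exact Eventually.of_forall fun _ => le_top
  have hηpos : 0 < η.toReal := ENNReal.toReal_pos hη.ne' hηt
  filter_upwards [h2 η.toReal hηpos] with m hm
  refine (eLpNorm_mono_measure _ (Measure.restrict_mono hR le_rfl)).trans ?_
  rw [eLpNorm_exponent_top, ← ENNReal.ofReal_toReal hηt]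
  refine eLpNormEssSup_le_of_ae_bound ?_
  filter_upwards [ae_restrict_mem Metric.isClosed_closedBall.measurableSet] with z hz
  have := (hm z hz).le
  rw [dist_comm, dist_eq_norm] at this
  exact this

end NetworkContinuity

/-! ### Truncated superposition operators -/

section Superposition

variable {X : Type*} [MeasurableSpace X] {μ : Measure X}

/-- Bounded convergence in `L^q`. -/
lemma tendsto_eLpNorm_sub_of_bounded [IsFiniteMeasure μ] {q : ℝ≥0∞} (hq0 : q ≠ 0) (hq : q ≠ ∞)
    {f : ℕ → X → ℝ}
    {g : X → ℝ} {C : ℝ} (hf : ∀ n, AEStronglyMeasurable (f n) μ) (hg : AEStronglyMeasurable g μ)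
    (hfC : ∀ n x, |f n x| ≤ C) (hgC : ∀ x, |g x| ≤ C)
    (hlim : ∀ᵐ x ∂μ, Tendsto (fun n => f n x) atTop (𝓝 (g x))) :
    Tendsto (fun n => eLpNorm (f n - g) q μ) atTop (𝓝 0) := by
  simp only [eLpNorm_eq_lintegral_rpow_enorm_toReal hq0 hq]
  have hqp : 0 < q.toReal := ENNReal.toReal_pos hq0 hq
  have h1 : Tendsto (fun n => ∫⁻ x, ‖(f n - g) x‖ₑ ^ q.toReal ∂μ) atTop (𝓝 0) := by
    have := tendsto_lintegral_of_dominated_convergence' (μ := μ)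
      (F := fun n x => ‖(f n - g) x‖ₑ ^ q.toReal) (f := fun _ => 0)
      (fun _ => ENNReal.ofReal (C + C) ^ q.toReal)
      (fun n => ((hf n).sub hg).enorm.pow_const _)
      (fun n => Eventually.of_forall fun x => by
        refine ENNReal.rpow_le_rpow ?_ hqp.le
        rw [← ofReal_norm]
        refine ENNReal.ofReal_le_ofReal ?_
        exact (norm_sub_le _ _).trans (add_le_add (hfC n x) (hgC x)))
      (by
        rw [lintegral_const]
        exact ENNReal.mul_ne_top (ENNReal.rpow_ne_top_of_nonneg hqp.le ENNReal.ofReal_ne_top)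
          (measure_ne_top _ _))
      (by
        filter_upwards [hlim] with x hx
        have h2 : Tendsto (fun n => ‖(f n - g) x‖ₑ) atTop (𝓝 0) := by
          have := (hx.sub_const (g x)).enorm
          simpa using this
        have h3 := (ENNReal.continuous_rpow_const (y := q.toReal)).continuousAt.tendsto.comp h2
        simpa only [Function.comp_def, ENNReal.zero_rpow_of_pos hqp] using h3)
    simpa using this
  have h2 := (ENNReal.continuous_rpow_const (y := 1 / q.toReal)).continuousAt.tendsto.comp h1
  simpa only [Function.comp_def, ENNReal.zero_rpow_of_pos (one_div_pos.2 hqp)] using h2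

/-- The truncation of a real number to `[-M,M]`. -/
def clip (M y : ℝ) : ℝ := max (-M) (min M y)

lemma continuous_clip (M : ℝ) : Continuous (clip M) := by
  unfold clip
  fun_prop

lemma clip_mem {M : ℝ} (hM : 0 ≤ M) (y : ℝ) : clip M y ∈ Icc (-M) M :=
  ⟨le_max_left _ _, max_le (by linarith) (min_le_left _ _)⟩

lemma clip_eq_self {M y : ℝ} (h : |y| ≤ M) : clip M y = y := by
  rw [clip, min_eq_right (abs_le.1 h).2, max_eq_right (abs_le.1 h).1]

variable {P J : Type*} [TopologicalSpace P] {p : ℝ≥0∞}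

lemma aestronglyMeasurable_superposition [Countable J] {F : P × (J → ℝ) → ℝ} (hF : Continuous F)
    (M : ℝ) (a : P)
    (w : J → Lp ℝ p μ) :
    AEStronglyMeasurable (fun x => F (a, fun j => clip M (w j x))) μ := by
  have h1 : AEMeasurable (fun x => fun j => clip M (w j x)) μ :=
    aemeasurable_pi_lambda _ fun j =>
      (continuous_clip M).measurable.comp_aemeasurable (Lp.aestronglyMeasurable (w j)).aemeasurable
  have h2 : Continuous fun y : J → ℝ => F (a, y) := by fun_prop
  exact (h2.measurable.comp_aemeasurable h1).aestronglyMeasurable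

/-- Truncation confines the arguments to a compact cube, so the bound is uniform in `w` and over
compact sets of parameters. -/
lemma exists_superposition_bound {F : P × (J → ℝ) → ℝ} (hF : Continuous F) {M : ℝ} (hM : 0 ≤ M)
    {S : Set P} (hS : IsCompact S) :
    ∃ C, ∀ a ∈ S, ∀ (w : J → Lp ℝ p μ) (x : X), |F (a, fun j => clip M (w j x))| ≤ C := by
  obtain ⟨C, hC⟩ := (hS.prod (isCompact_univ_pi fun _ : J =>
    isCompact_Icc (a := -M) (b := M))).exists_bound_of_continuousOn hF.continuousOn
  exact ⟨C, fun a ha w x => hC _ ⟨ha, fun j _ => clip_mem hM _⟩⟩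

lemma memLp_superposition [IsFiniteMeasure μ] [Countable J] {F : P × (J → ℝ) → ℝ}
    (hF : Continuous F) {M : ℝ} (hM : 0 ≤ M) (a : P)
    (w : J → Lp ℝ p μ) (q : ℝ≥0∞) : MemLp (fun x => F (a, fun j => clip M (w j x))) q μ := by
  obtain ⟨C, hC⟩ := exists_superposition_bound (μ := μ) (p := p) hF hM (isCompact_singleton (x := a))
  exact MemLp.of_bound (aestronglyMeasurable_superposition hF M a w) C
    (Eventually.of_forall fun x => hC a rfl w x)

/-- The superposition operator of a truncated continuous function. -/
noncomputable def superposition [IsFiniteMeasure μ] [Countable J] {F : P × (J → ℝ) → ℝ}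
    (hF : Continuous F) {M : ℝ} (hM : 0 ≤ M)
    (q : ℝ≥0∞) (z : P × (J → Lp ℝ p μ)) : Lp ℝ q μ :=
  (memLp_superposition hF hM z.1 z.2 q).toLp

/-- The superposition operator of a truncated continuous function is continuous. -/
lemma tendsto_superposition [IsFiniteMeasure μ] [Fintype J] [Fact (1 ≤ p)] {q : ℝ≥0∞}
    [Fact (1 ≤ q)] {F : P × (J → ℝ) → ℝ} (hF : Continuous F) {M : ℝ} (hM : 0 ≤ M)
    (hq : q ≠ ∞) {a : ℕ → P} {a₀ : P} (ha : Tendsto a atTop (𝓝 a₀)) {w : ℕ → J → Lp ℝ p μ}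
    {w₀ : J → Lp ℝ p μ} (hw : Tendsto w atTop (𝓝 w₀)) :
    Tendsto (fun n => superposition hF hM q (a n, w n)) atTop
      (𝓝 (superposition hF hM q (a₀, w₀))) := by
  obtain ⟨C, hC⟩ := exists_superposition_bound (μ := μ) (p := p) hF hM ha.isCompact_insert_range
  have hp0 : p ≠ 0 := (zero_lt_one.trans_le Fact.out).ne'
  have hq0 : q ≠ 0 := (zero_lt_one.trans_le Fact.out).ne'
  -- Convergence in L^p is pointwise only along subsequences, which suffices since the limit is
  -- prescribed. `H` adds the deviations of all components, so that one subsequence serves every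
  -- `j`.
  refine tendsto_of_subseq_tendsto fun ns hns => ?_
  set H : ℕ → X → ℝ := fun n => ∑ j, fun x => ‖(w (ns n) j - w₀ j : Lp ℝ p μ) x‖ with hH
  have hHlim : Tendsto (fun n => eLpNorm (H n - 0) p μ) atTop (𝓝 0) := by
    have h1 : ∀ j, Tendsto (fun n => eLpNorm (fun x => ‖(w (ns n) j - w₀ j : Lp ℝ p μ) x‖) p μ) atTop
        (𝓝 0) := by
      intro j
      have h2 : Tendsto (fun n => w (ns n) j - w₀ j) atTop (𝓝 0) := by
        have := ((tendsto_pi_nhds.1 hw j).comp hns).sub_const (w₀ j)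
        simpa using this
      have h3 := h2.enorm
      simpa only [eLpNorm_norm, Lp.enorm_def, enorm_zero] using h3
    have h4 := tendsto_finsetSum Finset.univ fun j _ => h1 j
    rw [Finset.sum_const_zero] at h4
    refine tendsto_of_tendsto_of_tendsto_of_le_of_le tendsto_const_nhds h4 (fun _ => zero_le)
      fun n => ?_
    rw [sub_zero]
    exact eLpNorm_sum_le (fun j _ => (Lp.aestronglyMeasurable _).norm) Fact.out
  have hHm : ∀ n, AEStronglyMeasurable (H n) μ := fun n =>
    Finset.aestronglyMeasurable_sum _ fun j _ => (Lp.aestronglyMeasurable _).norm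
  obtain ⟨ms, hms, hae⟩ := (tendstoInMeasure_of_tendsto_eLpNorm hp0 hHm
    aestronglyMeasurable_zero hHlim).exists_seq_tendsto_ae
  refine ⟨ms, ?_⟩
  have hns' : Tendsto (fun n => ns (ms n)) atTop atTop := hns.comp hms.tendsto_atTop
  refine (Lp.tendsto_Lp_iff_tendsto_eLpNorm'' _ (fun n => memLp_superposition hF hM (a (ns (ms n)))
    (w (ns (ms n))) q) _ (memLp_superposition hF hM a₀ w₀ q)).2 ?_
  refine tendsto_eLpNorm_sub_of_bounded hq0 hq (C := C)
    (fun n => aestronglyMeasurable_superposition hF M _ _)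
    (aestronglyMeasurable_superposition hF M _ _)
    (fun n x => hC _ (mem_insert_of_mem _ ⟨_, rfl⟩) _ x) (fun x => hC _ (mem_insert _ _) _ x) ?_
  have hsub : ∀ᵐ x ∂μ, ∀ n j, (w (ns (ms n)) j - w₀ j : Lp ℝ p μ) x = w (ns (ms n)) j x - w₀ j x := by
    rw [ae_all_iff]
    intro n
    rw [ae_all_iff]
    intro j
    filter_upwards [Lp.coeFn_sub (w (ns (ms n)) j) (w₀ j)] with x hx
    rw [hx, Pi.sub_apply]
  filter_upwards [hae, hsub] with x hx hx2
  refine (hF.tendsto (a₀, fun j => clip M (w₀ j x))).comp ?_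
  refine (ha.comp hns').prodMk_nhds (tendsto_pi_nhds.2 fun j => ?_)
  refine ((continuous_clip M).tendsto _).comp ?_
  rw [tendsto_iff_norm_sub_tendsto_zero]
  refine squeeze_zero (fun _ => norm_nonneg _) (fun n => ?_) hx
  rw [← hx2 n j]
  simp only [hH, Finset.sum_apply]
  exact Finset.single_le_sum (f := fun j => ‖(w (ns (ms n)) j - w₀ j : Lp ℝ p μ) x‖)
    (fun _ _ => norm_nonneg _) (Finset.mem_univ j)

lemma continuous_superposition [FirstCountableTopology P] [IsFiniteMeasure μ] [Fintype J]
    [Fact (1 ≤ p)] {q : ℝ≥0∞} [Fact (1 ≤ q)] {F : P × (J → ℝ) → ℝ} (hF : Continuous F) {M : ℝ}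
    (hM : 0 ≤ M) (hq : q ≠ ∞) :
    Continuous fun z : P × (J → Lp ℝ p μ) => superposition hF hM q z := by
  rw [continuous_iff_seqContinuous]
  intro z z₀ hz
  exact tendsto_superposition hF hM hq (Tendsto.fst_nhds hz) (Tendsto.snd_nhds hz)

end Superposition

/-! ### Passage to the limit in the equation -/

section LimitPassage

variable {d : ℕ} {Ω : Set (EuclideanSpace ℝ (Fin d))} {κ : ℕ} {p' q' : ℝ≥0∞}
  [Fact (1 ≤ p')] [Fact (1 ≤ q')] {V Z W : Type*}
  [NormedAddCommGroup V] [NormedSpace ℝ V] [NormedAddCommGroup Z] [NormedSpace ℝ Z]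
  [NormedAddCommGroup W] [NormedSpace ℝ W]
  {T : ℝ} {p : ℝ≥0∞} [Fact (1 ≤ p)]

/-- The arguments of a physical law, assembled from the time and the spatial derivatives. -/
def lawArg {J : Type} (t : ℝ) (y : J → ℝ) : Option J → ℝ
  | none => t
  | some β => y β

/-- Time is grouped with the parameters, as an argument that is not truncated; only the spatial
derivatives pass through `clip`. -/
lemma continuous_network_law (A : Architecture (LawIdx d κ)) {ε : ℝ} (hε : 0 < ε) :
    Continuous fun z : (A.paramSet ε × ℝ) × (MultiIdx (Fin d) κ → ℝ) =>
      A.eval z.1.1.1 (lawArg z.1.2 z.2) := by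
  refine (A.continuous_eval hε).comp ((continuous_fst.comp continuous_fst).prodMk
    (continuous_pi fun o => ?_))
  cases o with
  | none => exact continuous_snd.comp continuous_fst
  | some β => exact (continuous_apply β).comp continuous_snd

/-- The Nemytskii operator of a network law as a superposition operator. -/
noncomputable def networkNemytskii [IsFiniteMeasure (domMeasure Ω)]
    (E : StaticEmbeddings Ω κ p' q' V Z W) (A : Architecture (LawIdx d κ)) {ε : ℝ} (hε : 0 < ε)
    {M : ℝ} (hM : 0 ≤ M) (θ : A.paramSet ε) (u : StateSpace T p E.VZ) (t : ℝ) : W :=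
  E.LW (superposition (continuous_network_law A hε) hM q' ((θ, t), (E.VS (u.1.1 t)).1))

/-- Where the jet is bounded by `M` the truncation is inactive. The truncated operator has the
advantage of being defined, bounded and continuous without any bound on the state. -/
lemma nemytskii_eq_networkNemytskii [IsFiniteMeasure (domMeasure Ω)]
    (E : StaticEmbeddings Ω κ p' q' V Z W) (A : Architecture (LawIdx d κ)) {ε : ℝ} (hε : 0 < ε)
    {M : ℝ} (hM : 0 ≤ M) (θ : A.paramSet ε) (u : StateSpace T p E.VZ) {t : ℝ}
    (h : ∀ᵐ x ∂(domMeasure Ω), ∀ β : MultiIdx (Fin d) κ, |jet E u t x (some β)| ≤ M) :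
    nemytskii E (A.eval θ.1) u t = networkNemytskii E A hε hM θ u t := by
  have hae : (fun x => A.eval θ.1 (lawArg t fun β => clip M ((E.VS (u.1.1 t)).1 β x)))
      =ᵐ[domMeasure Ω] fun x => A.eval θ.1 (jet E u t x) := by
    filter_upwards [h] with x hx
    congr 1
    funext o
    cases o with
    | none => rfl
    | some β => exact clip_eq_self (hx β)
  have hmem := memLp_superposition (continuous_network_law A hε) hM (θ, t) (E.VS (u.1.1 t)).1 q'
  have hmem' : MemLp (fun x => A.eval θ.1 (jet E u t x)) q' (domMeasure Ω) :=
    (memLp_congr_ae hae).1 hmem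
  rw [nemytskii, dif_pos hmem', networkNemytskii, superposition]
  congr 1
  exact MemLp.toLp_congr _ _ hae.symm

lemma tendsto_networkNemytskii [IsFiniteMeasure (domMeasure Ω)] (hq' : q' ≠ ∞)
    (E : StaticEmbeddings Ω κ p' q' V Z W) (A : Architecture (LawIdx d κ)) {ε : ℝ} (hε : 0 < ε)
    {M : ℝ} (hM : 0 ≤ M) {θ : ℕ → A.paramSet ε} {θ₀ : A.paramSet ε} (hθ : Tendsto θ atTop (𝓝 θ₀))
    {u : ℕ → StateSpace T p E.VZ} {u₀ : StateSpace T p E.VZ} {t : ℝ}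
    (hu : Tendsto (fun n => E.VS ((u n).1.1 t)) atTop (𝓝 (E.VS (u₀.1.1 t)))) :
    Tendsto (fun n => networkNemytskii E A hε hM (θ n) (u n) t) atTop
      (𝓝 (networkNemytskii E A hε hM θ₀ u₀ t)) :=
  (E.LW.continuous.tendsto _).comp (tendsto_superposition _ hM hq'
    (hθ.prodMk_nhds tendsto_const_nhds) ((continuous_subtype_val.tendsto _).comp hu))

/-- For fixed parameters the truncated superposition is jointly continuous in time and jet, so
measurability in `t` is inherited from the state. -/
lemma aestronglyMeasurable_networkNemytskii [IsFiniteMeasure (domMeasure Ω)] (hq' : q' ≠ ∞)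
    (E : StaticEmbeddings Ω κ p' q' V Z W) (A : Architecture (LawIdx d κ)) {ε : ℝ} (hε : 0 < ε)
    {M : ℝ} (hM : 0 ≤ M) (θ : A.paramSet ε) (u : StateSpace T p E.VZ) :
    AEStronglyMeasurable (networkNemytskii E A hε hM θ u) (timeMeasure T) := by
  have hF : Continuous fun z : ℝ × (MultiIdx (Fin d) κ → ℝ) => A.eval θ.1 (lawArg z.1 z.2) :=
    (continuous_network_law A hε).comp
      ((continuous_const.prodMk continuous_fst).prodMk continuous_snd)
  have hcont := continuous_superposition (μ := domMeasure Ω) (p := p') hF hM hq'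
  have h2 : AEStronglyMeasurable (fun t => (E.VS (u.1.1 t)).1) (timeMeasure T) :=
    (continuous_subtype_val.comp E.VS.continuous).comp_aestronglyMeasurable
      (Lp.aestronglyMeasurable _)
  have h3 : AEStronglyMeasurable (fun t : ℝ => (t, (E.VS (u.1.1 t)).1)) (timeMeasure T) :=
    AEStronglyMeasurable.prodMk aestronglyMeasurable_id h2
  have h4 : AEStronglyMeasurable
      (fun t => superposition hF hM q' (t, (E.VS (u.1.1 t)).1)) (timeMeasure T) :=
    hcont.comp_aestronglyMeasurable h3
  have h5 : networkNemytskii E A hε hM θ u =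
      fun t => E.LW (superposition hF hM q' (t, (E.VS (u.1.1 t)).1)) := by
    funext t
    simp only [networkNemytskii, superposition]
  rw [h5]
  exact E.LW.continuous.comp_aestronglyMeasurable h4

lemma exists_networkNemytskii_bound [IsFiniteMeasure (domMeasure Ω)]
    (E : StaticEmbeddings Ω κ p' q' V Z W) (A : Architecture (LawIdx d κ)) {ε : ℝ} (hε : 0 < ε)
    {M : ℝ} (hM : 0 ≤ M) {S : Set (A.paramSet ε)} (hS : IsCompact S) :
    ∃ C, ∀ θ ∈ S, ∀ (u : StateSpace T p E.VZ), ∀ t ∈ Ioo 0 T,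
      ‖networkNemytskii E A hε hM θ u t‖ ≤ C := by
  obtain ⟨C, hC⟩ := exists_superposition_bound (μ := domMeasure Ω) (p := p')
    (continuous_network_law A hε) hM (hS.prod (isCompact_Icc (a := (0 : ℝ)) (b := T)))
  refine ⟨‖E.LW‖ * (measureUnivNNReal (domMeasure Ω) ^ q'.toReal⁻¹ * max C 0),
    fun θ hθ u t ht => ?_⟩
  refine (E.LW.le_opNorm _).trans ?_
  gcongr
  refine Lp.norm_le_of_ae_bound (le_max_right _ _) ?_
  have hmem := memLp_superposition (continuous_network_law A hε) hM (θ, t) (E.VS (u.1.1 t)).1 q'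
  filter_upwards [hmem.coeFn_toLp] with x hx
  rw [superposition, hx]
  exact (hC (θ, t) ⟨hθ, Ioo_subset_Icc_self ht⟩ _ x).trans (le_max_left _ _)

/-- Limits of approximate solutions are solutions for the limit law. -/
lemma timeDeriv_ae_eq_of_tendsto [IsFiniteMeasure (domMeasure Ω)] [CompleteSpace W]
    (hq' : q' ≠ ∞) {q : ℝ≥0∞} (hq1 : 1 ≤ q)
    (E : StaticEmbeddings Ω κ p' q' V Z W) (A : Architecture (LawIdx d κ)) {ε : ℝ} (hε : 0 < ε)
    {M : ℝ} (hM : 0 ≤ M) {θ : ℕ → A.paramSet ε} {θ₀ : A.paramSet ε} (hθ : Tendsto θ atTop (𝓝 θ₀))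
    {u : ℕ → StateSpace T p E.VZ} {u₀ : StateSpace T p E.VZ} (hu : WeakTendsto u u₀)
    (hVS : ∀ᵐ t ∂(timeMeasure T),
      Tendsto (fun n => E.VS ((u n).1.1 t)) atTop (𝓝 (E.VS (u₀.1.1 t))))
    (hres : Tendsto (fun n => eLpNorm (fun t => timeDeriv E (u n) t -
      networkNemytskii E A hε hM (θ n) (u n) t) q (timeMeasure T)) atTop (𝓝 0)) :
    timeDeriv E u₀ =ᵐ[timeMeasure T] networkNemytskii E A hε hM θ₀ u₀ := by
  obtain ⟨C, hC⟩ := exists_networkNemytskii_bound (T := T) (p := p) E A hε hM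
    hθ.isCompact_insert_range
  have hmemIoo : ∀ᵐ t ∂(timeMeasure T), t ∈ Ioo 0 T := ae_restrict_mem measurableSet_Ioo
  have hGm : ∀ θ (u : StateSpace T p E.VZ), AEStronglyMeasurable
      (networkNemytskii E A hε hM θ u) (timeMeasure T) := fun θ u =>
    aestronglyMeasurable_networkNemytskii hq' E A hε hM θ u
  have hGi : ∀ θ' ∈ insert θ₀ (range θ), ∀ (u : StateSpace T p E.VZ), Integrable
      (networkNemytskii E A hε hM θ' u) (timeMeasure T) := fun θ' hθ' u =>
    Integrable.of_bound (hGm _ _) C (hmemIoo.mono fun t ht => hC θ' hθ' u t ht)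
  have hDi : ∀ u : StateSpace T p E.VZ, Integrable (timeDeriv E u) (timeMeasure T) := fun u =>
    E.ZW.integrable_comp (integrable_lp_timeMeasure _)
  have hRi : ∀ n, Integrable (fun t => timeDeriv E (u n) t -
      networkNemytskii E A hε hM (θ n) (u n) t) (timeMeasure T) := fun n =>
    (hDi _).sub (hGi _ (mem_insert_of_mem _ ⟨n, rfl⟩) _)
  -- On a bounded interval the L^q norm of the residual controls its L^1 norm.
  have hR : Tendsto (fun n => ∫ t, ‖timeDeriv E (u n) t -
      networkNemytskii E A hε hM (θ n) (u n) t‖ ∂(timeMeasure T)) atTop (𝓝 0) := by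
    have h1 : Tendsto (fun n => eLpNorm (fun t => timeDeriv E (u n) t -
        networkNemytskii E A hε hM (θ n) (u n) t) 1 (timeMeasure T)) atTop (𝓝 0) := by
      set c : ℝ≥0∞ := timeMeasure T univ ^ (1 / (1 : ℝ≥0∞).toReal - 1 / q.toReal) with hc
      have hcfin : c ≠ ∞ := rpow_measure_univ_ne_top hq1
      have h2 := ENNReal.Tendsto.mul_const hres (Or.inr hcfin)
      rw [zero_mul] at h2
      exact tendsto_of_tendsto_of_tendsto_of_le_of_le tendsto_const_nhds h2 (fun _ => zero_le)
        fun n => eLpNorm_le_eLpNorm_mul_rpow_measure_univ hq1 (hRi n).aestronglyMeasurable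
    have h3 := (ENNReal.continuousAt_toReal ENNReal.zero_ne_top).tendsto.comp h1
    rw [ENNReal.toReal_zero] at h3
    refine h3.congr fun n => ?_
    rw [Function.comp_apply, eLpNorm_one_eq_lintegral_enorm,
      integral_norm_eq_lintegral_enorm (hRi n).aestronglyMeasurable]
  -- Integrals over measurable sets, tested with functionals, determine both sides. There the time
  -- derivatives converge weakly, the network terms converge by dominated convergence, and their
  -- difference is controlled by the vanishing residual.
  refine Integrable.ae_eq_of_forall_setIntegral_eq _ _ (hDi u₀)
    (hGi θ₀ (mem_insert _ _) u₀) fun s hs _ => ?_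
  refine (SeparatingDual.eq_iff_forall_dual_eq (R := ℝ)).2 fun ξ => ?_
  rw [← ξ.integral_comp_comm (hDi u₀).integrableOn,
    ← ξ.integral_comp_comm (hGi θ₀ (mem_insert _ _) u₀).integrableOn]
  have hlimD : Tendsto (fun n => ∫ t in s, ξ (timeDeriv E (u n) t) ∂(timeMeasure T)) atTop
      (𝓝 (∫ t in s, ξ (timeDeriv E u₀ t) ∂(timeMeasure T))) := by
    obtain ⟨l, hl⟩ := exists_clm_setIntegral (p := p) (T := T) hs (ξ.comp E.ZW)
    have h1 := hu.comp_clm ((ContinuousLinearMap.snd ℝ _ _).comp (StateSpace T p E.VZ).subtypeL) l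
    simp only [hl] at h1
    exact h1
  have hlimG : Tendsto (fun n => ∫ t in s, ξ (networkNemytskii E A hε hM (θ n) (u n) t)
      ∂(timeMeasure T)) atTop
      (𝓝 (∫ t in s, ξ (networkNemytskii E A hε hM θ₀ u₀ t) ∂(timeMeasure T))) := by
    refine tendsto_integral_of_dominated_convergence (fun _ => ‖ξ‖ * C)
      (fun n => (ξ.continuous.comp_aestronglyMeasurable (hGm _ _)).restrict)
      (integrable_const _) (fun n => ?_) ?_
    · refine ae_restrict_of_ae (hmemIoo.mono fun t ht => ?_)
      exact ξ.le_of_opNorm_le_of_le le_rfl (hC _ (mem_insert_of_mem _ ⟨n, rfl⟩) _ t ht)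
    · refine ae_restrict_of_ae (hVS.mono fun t ht => ?_)
      exact (ξ.continuous.tendsto _).comp (tendsto_networkNemytskii hq' E A hε hM hθ ht)
  have hlimR : Tendsto (fun n => ∫ t in s, ξ (timeDeriv E (u n) t) ∂(timeMeasure T) -
      ∫ t in s, ξ (networkNemytskii E A hε hM (θ n) (u n) t) ∂(timeMeasure T)) atTop (𝓝 0) := by
    refine squeeze_zero_norm (fun n => ?_) (by simpa using hR.const_mul ‖ξ‖)
    have hG' := hGi _ (mem_insert_of_mem θ₀ ⟨n, rfl⟩) (u n)
    rw [← integral_sub (ξ.integrable_comp (hDi (u n))).integrableOn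
      (ξ.integrable_comp hG').integrableOn, ← integral_const_mul]
    refine (norm_integral_le_integral_norm _).trans ?_
    refine (setIntegral_mono_on (g := fun t => ‖ξ‖ * ‖timeDeriv E (u n) t -
      networkNemytskii E A hε hM (θ n) (u n) t‖)
      ((ξ.integrable_comp (hDi (u n))).sub (ξ.integrable_comp hG')).norm.integrableOn
      ((hRi n).norm.const_mul _).integrableOn hs fun t _ => ?_).trans ?_
    · rw [Pi.sub_apply, ← map_sub]
      exact ξ.le_opNorm _
    · exact setIntegral_le_integral ((hRi n).norm.const_mul _)
        (Eventually.of_forall fun t => by positivity)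
  exact sub_eq_zero.1 (tendsto_nhds_unique (hlimD.sub hlimG) hlimR)

end LimitPassage

/-! ### Subsequences -/

section Convergence

/-- A sequence that converges along a subsequence converges after its other members have been
replaced by the limit. -/
lemma tendsto_ite_range {X : Type*} [TopologicalSpace X] {f : ℕ → X} {a : X} {m : ℕ → ℕ}
    (hm : StrictMono m) (h : Tendsto (fun k => f (m k)) atTop (𝓝 a))
    [∀ n, Decidable (n ∈ range m)] :
    Tendsto (fun n => if n ∈ range m then f n else a) atTop (𝓝 a) := by
  intro s hs
  obtain ⟨k₀, hk₀⟩ := mem_atTop_sets.1 (h hs)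
  refine mem_atTop_sets.2 ⟨m k₀, fun n hn => ?_⟩
  by_cases hmem : n ∈ range m
  · obtain ⟨k, rfl⟩ := hmem
    have h1 : f (m k) ∈ s := hk₀ k (hm.le_iff_le.1 hn)
    simpa using h1
  · simpa [hmem] using mem_of_mem_nhds hs

/-- Subsequences in the consistency of measurement operators. -/
lemma tendsto_measurement_subseq {E F : Type*} [NormedAddCommGroup E] [NormedSpace ℝ E]
    [NormedAddCommGroup F] {K : ℕ → E → F} {K₀ : E → F}
    (hK : ∀ (v : ℕ → E) (v₀ : E), WeakTendsto v v₀ →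
      Tendsto (fun m => K m (v m) - K₀ (v m)) atTop (𝓝 0))
    (hK₀ : WeakStrongContinuous K₀) {u : ℕ → E} {u₀ : E} {m : ℕ → ℕ} (hm : StrictMono m)
    (hu : WeakTendsto (fun k => u (m k)) u₀) :
    Tendsto (fun k => K (m k) (u (m k))) atTop (𝓝 (K₀ u₀)) := by
  classical
  -- The consistency hypothesis concerns full sequences. Filling the missing indices with the limit
  -- `u₀` keeps `K (m k)` paired with `u (m k)`.
  have hv : WeakTendsto (fun n => if n ∈ range m then u n else u₀) u₀ := by
    intro l
    have := tendsto_ite_range (f := fun n => l (u n)) hm (hu l)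
    refine this.congr fun n => ?_
    by_cases h : n ∈ range m <;> simp [h]
  have h1 := (hK _ _ hv).comp hm.tendsto_atTop
  have h2 : Tendsto (fun k => K (m k) (u (m k)) - K₀ (u (m k))) atTop (𝓝 0) := by
    refine h1.congr fun k => ?_
    simp
  simpa using h2.add (hK₀ _ _ hu)

lemma tendsto_zero_of_rpow_tendsto_zero {r : ℝ} (hr : 0 < r) {a : ℕ → ℝ} (ha : ∀ n, 0 ≤ a n)
    (h : Tendsto (fun n => a n ^ r) atTop (𝓝 0)) : Tendsto a atTop (𝓝 0) := by
  have h1 := ((Real.continuous_rpow_const (q := r⁻¹) (inv_nonneg.2 hr.le)).tendsto 0).comp h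
  rw [Real.zero_rpow (inv_ne_zero hr.ne')] at h1
  exact h1.congr fun n => Real.rpow_rpow_inv (ha n) hr.ne'

/-- Functions that converge strongly in `L^1` have a subsequence that converges pointwise. -/
lemma exists_subseq_ae_tendsto_of_integral_norm {X S : Type*} [MeasurableSpace X] {μ : Measure X}
    [NormedAddCommGroup S] {f : ℕ → X → S} {g : X → S} (hf : ∀ n, Integrable (f n) μ)
    (hg : Integrable g μ)
    (h : Tendsto (fun n => ∫ x, ‖f n x - g x‖ ∂μ) atTop (𝓝 0)) :
    ∃ φ : ℕ → ℕ, StrictMono φ ∧ ∀ᵐ x ∂μ, Tendsto (fun n => f (φ n) x) atTop (𝓝 (g x)) := by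
  have h1 : Tendsto (fun n => eLpNorm (f n - g) 1 μ) atTop (𝓝 0) := by
    have h2 := ENNReal.tendsto_ofReal h
    rw [ENNReal.ofReal_zero] at h2
    refine h2.congr fun n => ?_
    rw [eLpNorm_one_eq_lintegral_enorm]
    exact ofReal_integral_norm_eq_lintegral_enorm ((hf n).sub hg)
  exact (tendstoInMeasure_of_tendsto_eLpNorm one_ne_zero
    (fun n => (hf n).aestronglyMeasurable) hg.aestronglyMeasurable h1).exists_seq_tendsto_ae

/-- Bounded sequences of parameters have convergent subsequences. -/
lemma Architecture.exists_subseq_tendsto {ι : Type} [Fintype ι] [DecidableEq ι]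
    (A : Architecture ι) {ε : ℝ} {θ : ℕ → A.paramSet ε} (hb : Bornology.IsBounded (range θ)) :
    ∃ (θ₀ : A.paramSet ε) (φ : ℕ → ℕ), StrictMono φ ∧
      Tendsto (fun k => θ (φ k)) atTop (𝓝 θ₀) := by
  have := A.properSpace_paramSet ε
  obtain ⟨θ₀, -, φ, hφ, h⟩ := tendsto_subseq_of_bounded hb fun k => ⟨k, rfl⟩
  exact ⟨θ₀, φ, hφ, h⟩

end Convergence

end SymbolicLearning

/-! ### Convergence of the identified laws -/

theorem corollary3p7
    -- the domain, the final time and the exponents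
    {d : ℕ} {Ω : Set (EuclideanSpace ℝ (Fin d))} (hΩo : IsOpen Ω) (hΩb : Bornology.IsBounded Ω)
    {T : ℝ} (hT : 0 < T) (κ : ℕ)
    (p q r p' q' : ℝ≥0∞) [Fact (1 ≤ p)] [Fact (1 ≤ q)] [Fact (1 ≤ r)] [Fact (1 ≤ p')]
    [Fact (1 ≤ q')] (hp1 : 1 < p) (hp : p ≠ ∞) (hqp : q ≤ p) (hr : r ≠ ∞)
    (hqp' : q' ≤ p') (hp' : p' ≠ ∞)
    -- the static spaces and their embeddings
    {V Z W Y : Type*}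
    [NormedAddCommGroup V] [NormedSpace ℝ V] [CompleteSpace V] [TopologicalSpace.SeparableSpace V]
    [NormedAddCommGroup Z] [NormedSpace ℝ Z] [CompleteSpace Z] [TopologicalSpace.SeparableSpace Z]
    [NormedAddCommGroup W] [NormedSpace ℝ W] [CompleteSpace W] [TopologicalSpace.SeparableSpace W]
    [NormedAddCommGroup Y] [NormedSpace ℝ Y] [CompleteSpace Y]
    (hV : IsReflexive V) (hZ : IsReflexive Z)
    (hW : IsReflexive W)
    (E : StaticEmbeddings Ω κ p' q' V Z W)
    (hreg : UniformRegularity E T p)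
    -- the norm of the state space used in the regularization
    (N : Seminorm ℝ (StateSpace T p E.VZ))
    (hN : ∃ c C : ℝ, 0 < c ∧ ∀ u, c * ‖u‖ ≤ N u ∧ N u ≤ C * ‖u‖)
    -- the network and the regularization of its parameters
    (A : Architecture (LawIdx d κ)) {ε : ℝ} (hε : 0 < ε)
    (R₀ : A.paramSet ε → ℝ≥0∞) (hR₀_proper : ∃ θ, R₀ θ ≠ ∞)
    (hR₀_coercive : Tendsto R₀ (Bornology.cobounded (A.paramSet ε)) (𝓝 ∞))
    (hR₀_lsc : LowerSemicontinuous R₀)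
    -- the measurement operators
    (Kdag : StateSpace T p E.VZ → Lp Y r (timeMeasure T))
    (hKdag_inj : Function.Injective Kdag) (hKdag : WeakStrongContinuous Kdag)
    (K : ℕ → StateSpace T p E.VZ → Lp Y r (timeMeasure T))
    (hK : ∀ m, WeakWeakContinuous (K m))
    (hK_conv : ∀ (v : ℕ → StateSpace T p E.VZ) (v₀ : _),
      WeakTendsto v v₀ →
        Tendsto (fun m => K m (v m) - Kdag (v m)) atTop (𝓝 0))
    -- the admissible solution, whose law is represented by the network
    (udag : StateSpace T p E.VZ)
    (ydag : Lp Y r (timeMeasure T)) (hydag : Kdag udag = ydag)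
    (fdag : (LawIdx d κ → ℝ) → ℝ)
    (hpde : SolvesPDE E fdag udag)
    (hrep : ∃ θdag : A.paramSet ε, fdag = A.eval θdag.1 ∧ R₀ θdag ≠ ∞)
    -- noisy data and parameter choice
    (y : ℕ → Lp Y r (timeMeasure T)) (δ : ℕ → ℝ)
    (hnoise : ∀ m, ‖y m - K m udag‖ ^ r.toReal ≤ δ m) (hδ : Tendsto δ atTop (𝓝 0))
    (lam mu : ℕ → ℝ) (hlam_pos : ∀ m, 0 < lam m) (hmu_pos : ∀ m, 0 < mu m)
    (hlam : Tendsto lam atTop atTop) (hmu : Tendsto mu atTop atTop)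
    (hmuδ : Tendsto (fun m => mu m * δ m) atTop (𝓝 0))
    -- solutions of the minimization problems
    (u : ℕ → StateSpace T p E.VZ) (θ : ℕ → A.paramSet ε)
    (hmin : ∀ m v η,
      objective E q A ε N R₀ (lam m) (mu m) (K m) (y m) (u m) (θ m) ≤
        objective E q A ε N R₀ (lam m) (mu m) (K m) (y m) v η)
    -- identifiability within the class of network laws
    (hident : Identifiable E
      (Set.range fun η : A.paramSet ε => A.eval η.1) udag) :
    ∀ U : Set (LawIdx d κ → ℝ), Bornology.IsBounded U →
      Tendsto (fun m => eLpNorm (fun z => A.eval (θ m).1 z - fdag z) ∞ (volume.restrict U))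
        atTop (𝓝 0) := by
  have hΩfin : IsFiniteMeasure (domMeasure Ω) := ⟨by simpa using hΩb.measure_lt_top⟩
  obtain ⟨θdag, rfl, hθdag⟩ := hrep
  obtain ⟨cN, CN, hcN, hNle⟩ := hN
  obtain ⟨cr, hcr, hreg⟩ := hreg
  have hp0 : 0 < p.toReal := ENNReal.toReal_pos (zero_lt_one.trans hp1).ne' hp
  have hq1 : (1 : ℝ≥0∞) ≤ q := Fact.out
  have hqt : q ≠ ∞ := (hqp.trans_lt hp.lt_top).ne
  have hq0 : 0 < q.toReal := ENNReal.toReal_pos (zero_lt_one.trans_le hq1).ne' hqt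
  have hr0 : 0 < r.toReal := ENNReal.toReal_pos (zero_lt_one.trans_le Fact.out).ne' hr
  have hq't : q' ≠ ∞ := (hqp'.trans_lt hp'.lt_top).ne
  -- the energy estimate
  obtain ⟨Cδ, hCδ⟩ := hmuδ.bddAbove_range
  set C : ℝ≥0∞ := ENNReal.ofReal Cδ + ENNReal.ofReal (N udag ^ p.toReal) + R₀ θdag with hC
  have hCfin : C ≠ ∞ := by simp [hC, hθdag]
  have hobj : ∀ m, objective E q A ε N R₀ (lam m) (mu m) (K m) (y m) (u m) (θ m) ≤ C := by
    intro m
    -- The admissible pair is a competitor: its residual vanishes, and its misfit term is at most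
    -- `mu m * δ m ≤ Cδ`.
    refine (hmin m udag θdag).trans ?_
    have e1 : eLpNorm (fun t => timeDeriv E udag t - nemytskii E (A.eval θdag.1) udag t) q
        (timeMeasure T) = 0 := by
      rw [eLpNorm_congr_ae (g := 0), eLpNorm_zero]
      filter_upwards [hpde] with t ht
      rw [ht, sub_self, Pi.zero_apply]
    rw [objective, e1, ENNReal.zero_rpow_of_pos hq0, mul_zero, zero_add, hC]
    gcongr
    refine le_trans ?_ (hCδ ⟨m, rfl⟩)
    rw [norm_sub_rev]
    exact mul_le_mul_of_nonneg_left (hnoise m) (hmu_pos m).le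
  have hres_le : ∀ m, ENNReal.ofReal (lam m) * eLpNorm (fun t => timeDeriv E (u m) t -
      nemytskii E (A.eval (θ m).1) (u m) t) q (timeMeasure T) ^ q.toReal ≤ C := fun m =>
    le_trans (by rw [objective, add_assoc, add_assoc]; exact le_self_add) (hobj m)
  have hmeas_le : ∀ m, ENNReal.ofReal (mu m * ‖K m (u m) - y m‖ ^ r.toReal) ≤ C := fun m =>
    le_trans (by rw [objective, add_assoc]; exact le_add_self.trans le_self_add) (hobj m)
  have hN_le : ∀ m, ENNReal.ofReal (N (u m) ^ p.toReal) ≤ C := fun m =>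
    le_trans (le_add_self.trans le_self_add) (hobj m)
  have hR_le : ∀ m, R₀ (θ m) ≤ C := fun m => le_trans le_add_self (hobj m)
  -- bounds
  obtain ⟨B, hB0, hB⟩ : ∃ B : ℝ, 0 ≤ B ∧ ∀ m, ‖u m‖ ≤ B := by
    refine ⟨C.toReal ^ p.toReal⁻¹ / cN, by positivity, fun m => ?_⟩
    rw [le_div_iff₀ hcN, mul_comm]
    refine (hNle (u m)).1.trans ?_
    have := (ENNReal.ofReal_le_iff_le_toReal hCfin).1 (hN_le m)
    exact (Real.le_rpow_inv_iff_of_pos (apply_nonneg N _) ENNReal.toReal_nonneg hp0).2 this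
  have hbd : Bornology.IsBounded (range θ) := by
    have h1 : ∀ᶠ η in Bornology.cobounded (A.paramSet ε), C < R₀ η :=
      hR₀_coercive.eventually (lt_mem_nhds hCfin.lt_top)
    refine Bornology.isBounded_def.2 (mem_of_superset h1 ?_)
    rintro η hη ⟨m, rfl⟩
    exact (hR_le m).not_gt hη
  have hres0 : Tendsto (fun m => eLpNorm (fun t => timeDeriv E (u m) t -
      nemytskii E (A.eval (θ m).1) (u m) t) q (timeMeasure T)) atTop (𝓝 0) := by
    have h1 : Tendsto (fun m => C / ENNReal.ofReal (lam m)) atTop (𝓝 0) := by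
      have := ENNReal.Tendsto.const_div (ENNReal.tendsto_ofReal_atTop.comp hlam)
        (Or.inr hCfin)
      simpa using this
    have h2 : Tendsto (fun m => eLpNorm (fun t => timeDeriv E (u m) t -
        nemytskii E (A.eval (θ m).1) (u m) t) q (timeMeasure T) ^ q.toReal) atTop (𝓝 0) := by
      refine tendsto_of_tendsto_of_tendsto_of_le_of_le tendsto_const_nhds h1 (fun _ => zero_le)
        fun m => ?_
      rw [ENNReal.le_div_iff_mul_le (Or.inl (ENNReal.ofReal_pos.2 (hlam_pos m)).ne')
        (Or.inl ENNReal.ofReal_ne_top), mul_comm]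
      exact hres_le m
    have h3 := ((ENNReal.continuous_rpow_const (y := q.toReal⁻¹)).tendsto 0).comp h2
    rw [ENNReal.zero_rpow_of_pos (inv_pos.2 hq0)] at h3
    exact h3.congr fun m => ENNReal.rpow_rpow_inv hq0.ne' _
  have hmeas0 : Tendsto (fun m => K m (u m) - y m) atTop (𝓝 0) := by
    rw [tendsto_zero_iff_norm_tendsto_zero]
    refine tendsto_zero_of_rpow_tendsto_zero hr0 (fun _ => norm_nonneg _) ?_
    refine squeeze_zero (fun _ => by positivity) (fun m => ?_)
      (tendsto_const_nhds (x := C.toReal).div_atTop hmu)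
    rw [le_div_iff₀ (hmu_pos m), mul_comm]
    exact (ENNReal.ofReal_le_iff_le_toReal hCfin).1 (hmeas_le m)
  have hdata0 : Tendsto (fun m => y m - K m udag) atTop (𝓝 0) := by
    rw [tendsto_zero_iff_norm_tendsto_zero]
    exact tendsto_zero_of_rpow_tendsto_zero hr0 (fun _ => norm_nonneg _)
      (squeeze_zero (fun _ => by positivity) hnoise hδ)
  -- Consistency applied to a constant sequence identifies the limit of the exact measurements of
  -- `udag`.
  have hKconst : Tendsto (fun m => K m udag) atTop (𝓝 (Kdag udag)) :=
    tendsto_measurement_subseq hK_conv hKdag (u := fun _ => udag) strictMono_id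
      fun l => tendsto_const_nhds
  have hKu : Tendsto (fun m => K m (u m)) atTop (𝓝 (Kdag udag)) := by
    simpa using (hmeas0.add hdata0).add hKconst
  -- every subsequence has a further subsequence along which the claim holds
  intro U hU
  refine tendsto_of_subseq_tendsto fun ns hns => ?_
  -- `ns` merely tends to infinity; a strictly monotone choice of indices is needed for
  -- `tendsto_measurement_subseq`.
  obtain ⟨φ₁, hφ₁, hns₁⟩ := strictMono_subseq_of_tendsto_atTop hns
  obtain ⟨u₀, φ₂, hφ₂, hu₀⟩ := StateSpace.exists_weakTendsto_subseq hV hZ hp1 hp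
    (u := fun k => u (ns (φ₁ k))) fun k => hB _
  obtain ⟨θ₀, φ₃, hφ₃, hθ₀⟩ := A.exists_subseq_tendsto
    (θ := fun k => θ (ns (φ₁ (φ₂ k)))) (hbd.subset (range_subset_iff.2 fun k => ⟨_, rfl⟩))
  have hm₃ : StrictMono fun k => ns (φ₁ (φ₂ (φ₃ k))) := (hns₁.comp hφ₂).comp hφ₃
  have hu₃ : WeakTendsto (fun k => u (ns (φ₁ (φ₂ (φ₃ k))))) u₀ := hu₀.comp_strictMono hφ₃
  -- The same measurements converge to `Kdag u₀` by consistency and to `Kdag udag` by the vanishing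
  -- misfit.
  have hu₀_eq : u₀ = udag := hKdag_inj (tendsto_nhds_unique
    (tendsto_measurement_subseq hK_conv hKdag hm₃ hu₃) (hKu.comp hm₃.tendsto_atTop))
  subst hu₀_eq
  -- strong convergence of the states
  have hsub : WeakTendsto (fun k => u (ns (φ₁ (φ₂ (φ₃ k)))) - u₀) 0 := by
    intro l
    have := (hu₃ l).sub_const (l u₀)
    simpa using this
  have hsub_le : ∀ k, ‖u (ns (φ₁ (φ₂ (φ₃ k)))) - u₀‖ ≤ B + ‖u₀‖ := fun k =>
    (norm_sub_le (u (ns (φ₁ (φ₂ (φ₃ k))))) u₀).trans (add_le_add (hB _) le_rfl)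
  have hL1 := tendsto_integral_norm_of_weakTendsto hT hV E.VZ_injective E.VS_compact
    hsub_le hsub
  have hVSi : ∀ v : StateSpace T p E.VZ, Integrable (fun t => E.VS (v.1.1 t)) (timeMeasure T) :=
    fun v => E.VS.integrable_comp (integrable_lp_timeMeasure _)
  obtain ⟨φ₄, hφ₄, hae⟩ := exists_subseq_ae_tendsto_of_integral_norm
    (f := fun k t => E.VS ((u (ns (φ₁ (φ₂ (φ₃ k))))).1.1 t)) (fun k => hVSi _) (hVSi u₀)
    (by
      refine hL1.congr fun k => integral_congr_ae ?_
      filter_upwards [Lp.coeFn_sub (u (ns (φ₁ (φ₂ (φ₃ k))))).1.1 u₀.1.1] with t ht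
      rw [← map_sub]
      congr 2)
  have hm₄ : StrictMono fun k => ns (φ₁ (φ₂ (φ₃ (φ₄ k)))) := hm₃.comp hφ₄
  -- passage to the limit in the equation
  have hM : 0 ≤ cr * (B + ‖u₀‖) := by positivity
  have hnem : ∀ (η : A.paramSet ε) (v : StateSpace T p E.VZ), ‖v‖ ≤ B + ‖u₀‖ →
      nemytskii E (A.eval η.1) v =ᵐ[timeMeasure T] networkNemytskii E A hε hM η v := by
    intro η v hv
    filter_upwards [hreg v] with t ht
    refine nemytskii_eq_networkNemytskii E A hε hM η v (ht.mono fun x hx β => ?_)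
    exact (hx β).trans (mul_le_mul_of_nonneg_left hv hcr.le)
  have hθ₄ : Tendsto (fun k => θ (ns (φ₁ (φ₂ (φ₃ (φ₄ k)))))) atTop (𝓝 θ₀) :=
    hθ₀.comp hφ₄.tendsto_atTop
  have hlim := timeDeriv_ae_eq_of_tendsto hq't hq1 E A hε hM hθ₄ (hu₃.comp_strictMono hφ₄) hae
    (by
      refine (hres0.comp hm₄.tendsto_atTop).congr fun k => eLpNorm_congr_ae ?_
      filter_upwards [hnem (θ (ns (φ₁ (φ₂ (φ₃ (φ₄ k)))))) (u (ns (φ₁ (φ₂ (φ₃ (φ₄ k))))))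
        ((hB _).trans (le_add_of_nonneg_right (norm_nonneg _)))] with t ht
      rw [ht]
      rfl)
  -- The time derivative of `u₀`, which is now the exact state, equals both laws evaluated along its
  -- jet; only the functions are identified, not the parameters.
  have heq : A.eval θ₀.1 = A.eval θdag.1 :=
    hident _ ⟨θ₀, rfl⟩ _ ⟨θdag, rfl⟩ ((hnem θ₀ u₀ (le_add_of_nonneg_left hB0)).trans
      (hlim.symm.trans hpde))
  refine ⟨fun k => φ₁ (φ₂ (φ₃ (φ₄ k))), ?_⟩
  rw [← heq]
  exact A.tendsto_eLpNorm_eval hε hθ₄ hU
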